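/- Fix $\theta>0$ and let $p_k=\theta/(\theta+k-1)$ for $k\ge 1$. In the last-success problem, $N$ is a random number of trials with an arbitrary distribution on $\{0,1,2,\dots\}$ (the prior), $U_1,U_2,\dots$ are uniform on $[0,1]$, and $X_1,X_2,\dots$ are indicators with $\mathbb P(X_k=1)=p_k$, all these random variables being independent. The trials take place at the epochs $T_1<\dots<T_N$, the order statistics of $U_1,\dots,U_N$, and the trial at $T_k$ is a success if $X_k=1$. Let $\mathcal F_t$ be the $\sigma$-algebra generated by the epochs and outcomes of the trials on $[0,t]$. A strategy is a random time $\tau$ with $\{\tau\le t\}\in\mathcal F_t$ for $t\in[0,1]$ whose value is either the epoch of a success or $1$ (which means not stopping); it wins if $\tau<1$ is the epoch of the last success. The strategy with cutoffs $b_1,b_2,\dots$ stops at the first success $(T_k,k)$ with $b_k\le T_k<1$. Proposition. Let $b_k>0$ for all $k\ge1$ and $\lim_{k\to\infty}b_k=e^{-1/\theta}$. Then the strategy $\tau$ with cutoffs $b_1,b_2,\dots$ is asymptotically optimal as $N\to\infty$ in probability. That is, $\tau$ is a strategy in the above sense, and along any family (sequence or net) of last-success problems with this $\theta$ whose priors satisfy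 $\mathbb P(N\le K)\to0$ for every fixed $K$, the difference between the supremum of the winning probabilities over all strategies and the winning probability of $\tau$ converges to $0$, and the winning probability of $\tau$ converges to $e^{-1}$. -/

import Mathlib

open MeasureTheory ProbabilityTheory Filter Topology

noncomputable section

namespace LastSuccess

/-- The success profile `p_k = θ / (θ + k - 1)`, used for `k ≥ 1`. -/
def profile (θ : ℝ) (k : ℕ) : ℝ := θ / (θ + (k : ℝ) - 1)

/-- The random ingredients of the last-success problem with profile `p` on a probability space
`(Ω, μ)`: the number of trials `N` (its law is the prior, which is arbitrary), the positions
`U 1, U 2, …`, uniform on `[0,1]`, and the outcomes `X 1, X 2, …`, where `X k = true` means that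
the trial with chronological index `k` is a success, an event of probability `p k`.  All of them
are independent.  The entries `U 0` and `X 0` play no role and have no prescribed law (they may be
constants). -/
structure Model {Ω : Type*} [MeasurableSpace Ω] (μ : Measure Ω) (p : ℕ → ℝ) where
  N : Ω → ℕ
  U : ℕ → Ω → ℝ
  X : ℕ → Ω → Bool
  measurable_N : Measurable N
  measurable_U : ∀ n, Measurable (U n)
  measurable_X : ∀ k, Measurable (X k)
  law_U : ∀ n, 1 ≤ n → μ.map (U n) = volume.restrict (Set.Icc 0 1)
  law_X : ∀ k, 1 ≤ k → μ {ω | X k ω = true} = ENNReal.ofReal (p k)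
  indep_U : iIndepFun U μ
  indep_X : iIndepFun X μ
  indep_U_X : IndepFun (fun ω n => U n ω) (fun ω k => X k ω) μ
  indep_N : IndepFun N (fun ω => ((fun n => U n ω : ℕ → ℝ), (fun k => X k ω : ℕ → Bool))) μ

namespace Model

variable {Ω : Type*} [MeasurableSpace Ω] {μ : Measure Ω} {p : ℕ → ℝ} (M : Model μ p)

/-- The mixed binomial process `N_t = #{1 ≤ n ≤ N : U_n ≤ t}`. -/
def count (t : ℝ) (ω : Ω) : ℕ :=
  ((Finset.Icc 1 (M.N ω)).filter (fun n => M.U n ω ≤ t)).card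

/-- The epoch `T_k`, i.e. the `k`-th order statistic of `U_1, …, U_N`.
It is meaningful, and used below, only for `1 ≤ k ≤ N`. -/
def epoch (k : ℕ) (ω : Ω) : ℝ := sInf {t : ℝ | k ≤ M.count t ω}

/-- The trial with index `k` takes place (`1 ≤ k ≤ N`) and is a success. -/
def IsSuccess (k : ℕ) (ω : Ω) : Prop := 1 ≤ k ∧ k ≤ M.N ω ∧ M.X k ω = true

/-- The natural filtration: the σ-algebra of all the information about epochs and outcomes of the
trials on `[0,t]`, generated by the counts `N_s` and by the events
"trial `k` has occurred by time `s` and is a success", for `0 ≤ s ≤ t` and `k ≥ 1`. -/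
@[reducible] def observed (t : ℝ) : MeasurableSpace Ω :=
  MeasurableSpace.generateFrom
    ({A | ∃ s ∈ Set.Icc 0 t, ∃ k : ℕ, A = {ω | M.count s ω = k}} ∪
     {A | ∃ s ∈ Set.Icc 0 t, ∃ k : ℕ, 1 ≤ k ∧ A = {ω | k ≤ M.count s ω ∧ M.X k ω = true}})

/-- Nonanticipating stopping strategies which stop only at successes: `τ` is either the epoch of a
success or `1` (no stopping), and it is adapted to the natural filtration. -/
def IsStrategy (τ : Ω → ℝ) : Prop :=
  (∀ ω, τ ω = 1 ∨ ∃ k, M.IsSuccess k ω ∧ τ ω = M.epoch k ω) ∧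
  ∀ t ∈ Set.Icc (0 : ℝ) 1, MeasurableSet[M.observed t] {ω | τ ω ≤ t}

/-- The event that `τ` stops (before time `1`) at the last success. -/
def winEvent (τ : Ω → ℝ) : Set Ω :=
  {ω | τ ω < 1 ∧ ∃ k, M.IsSuccess k ω ∧ τ ω = M.epoch k ω ∧ ∀ j, k < j → ¬ M.IsSuccess j ω}

/-- The winning probability of `τ`. -/
def winProb (τ : Ω → ℝ) : ℝ := μ.real (M.winEvent τ)

/-- The optimal winning probability: the supremum over all nonanticipating strategies. -/
def optimalWinProb : ℝ := sSup {w | ∃ τ, M.IsStrategy τ ∧ w = M.winProb τ}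

open Classical in
/-- The Markovian strategy with stopping set `B`: stop at the first success `(T_k, k)` which falls
in `B`; if there is none, the value is `1`. -/
def markov (B : Set (ℝ × ℕ)) (ω : Ω) : ℝ :=
  if ∃ k, M.IsSuccess k ω ∧ (M.epoch k ω, k) ∈ B then
    M.epoch (sInf {k | M.IsSuccess k ω ∧ (M.epoch k ω, k) ∈ B}) ω
  else 1

end Model

/-- The stopping set `⋃_{k ≥ 1} [b_k, 1) × {k}` given by cutoffs `b_1, b_2, …`. -/
def cutoffSet (b : ℕ → ℝ) : Set (ℝ × ℕ) := {x | 1 ≤ x.2 ∧ x.1 ∈ Set.Ico (b x.2) 1}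

end LastSuccess

end

/-! Everything is reduced to a fixed number `n` of trials, with thresholds on `n` that depend on
`θ`, `b` and `ε` but not on the model. The fibres `N = n` are then summed, and the small values of
`N` cost only a probability that tends to `0`.

Upper bound: even an observer who knows `N` and all positions wins at most about `e⁻¹`. For such an
observer the value obeys the recursion of the odds theorem. If `O` is the sum of the odds after the
odds threshold, the winning probability is about `O * exp (-O)`, hence at most about `e⁻¹`. The
inputs are `exists_potential`, `sum_reward_le_potential` and the independence of later outcomes from
the past (`measure_past_inter`), combined in `measureReal_winEvent_le`.

Lower bound: the odds of trial `i + 1` are `θ / i`, so the odds after index `c n` sum to about `-θ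
log c`, which is `1` at `c = e^{-1/θ}`. By the law of large numbers about `c n` trials have occurred
by time `c`, so cutoffs near `c` imitate the threshold index `c n`. The finitely many early cutoffs
are harmless because they are positive and the early trials occur close to time `0`. The strategy
then wins when exactly one success lies beyond index `c n`, up to a narrow window (`exists_window`,
`mem_winEvent_of_onlySuccess`, `exists_le_winProb_markov`). -/

namespace LastSuccess

/-! ### Dynamic-programming bound. -/

/-- Weak duality for optimal stopping at successes: a potential `V` that dominates the reward
`r k` in the sense of dynamic programming bounds the total expected reward. -/
theorem sum_reward_le_potential {p r V d : ℕ → ℝ} {a : ℝ} {n : ℕ}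
    (hQ : ∀ k, k ≤ n → 0 ≤ a - ∑ j ∈ Finset.range k, d (j + 1))
    (hd0 : ∀ k, 0 ≤ d k)
    (hd : ∀ k, k < n → d (k + 1) ≤ p (k + 1) * (a - ∑ j ∈ Finset.range k, d (j + 1)))
    (hV : ∀ k, k < n → V (k + 1) ≤ V k)
    (hVr : ∀ k, k < n → V (k + 1) + p (k + 1) * (r (k + 1) - V (k + 1)) ≤ V k)
    (hVn : 0 ≤ V n) :
    ∑ j ∈ Finset.range n, d (j + 1) * r (j + 1) ≤ a * V 0 := by
  -- Here `d` is the mass stopped at each index. Reward collected so far plus remaining mass times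
  -- the current potential never exceeds its initial value.
  have key : ∀ k, k ≤ n → ∑ j ∈ Finset.range k, d (j + 1) * r (j + 1)
      + (a - ∑ j ∈ Finset.range k, d (j + 1)) * V k ≤ a * V 0 := by
    intro k
    induction k with
    | zero => intro _; simp
    | succ k ih =>
      intro hk
      have hk' : k < n := hk
      have h1 := ih hk'.le
      have hq := hQ k hk'.le
      have hdk := hd k hk'
      rw [Finset.sum_range_succ, Finset.sum_range_succ]
      set Q := a - ∑ j ∈ Finset.range k, d (j + 1) with hQdef
      have hQ' : a - (∑ j ∈ Finset.range k, d (j + 1) + d (k + 1)) = Q - d (k + 1) := by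
        rw [hQdef]; ring
      rw [hQ']
      suffices d (k + 1) * r (k + 1) + (Q - d (k + 1)) * V (k + 1) ≤ Q * V k by linarith
      rcases le_total (r (k + 1)) (V (k + 1)) with h | h
      · have := mul_le_mul_of_nonneg_left h (hd0 (k + 1))
        have := mul_le_mul_of_nonneg_left (hV k hk') hq
        linarith
      · have h2 := mul_le_mul_of_nonneg_right hdk (sub_nonneg.2 h)
        have := mul_le_mul_of_nonneg_left (hVr k hk') hq
        linarith
  have := key n le_rfl
  have := mul_nonneg (hQ n le_rfl) hVn
  linarith

/-! ### Odds sums of the profile. -/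

/-- The probability of no success among the trials `k + 1, …, n`. -/
noncomputable def noSuccessProb (p : ℕ → ℝ) (n k : ℕ) : ℝ := ∏ j ∈ Finset.Ioc k n, (1 - p j)

/-- The sum of the odds of the trials `k + 1, …, n`. -/
noncomputable def oddsSum (p : ℕ → ℝ) (n k : ℕ) : ℝ := ∑ j ∈ Finset.Ioc k n, p j / (1 - p j)

theorem Ioc_eq_insert_succ {k n : ℕ} (h : k < n) :
    Finset.Ioc k n = insert (k + 1) (Finset.Ioc (k + 1) n) := by
  ext j; simp; omega

theorem noSuccessProb_eq_mul {p : ℕ → ℝ} {n k : ℕ} (h : k < n) :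
    noSuccessProb p n k = (1 - p (k + 1)) * noSuccessProb p n (k + 1) := by
  rw [noSuccessProb, Ioc_eq_insert_succ h, Finset.prod_insert (by simp), noSuccessProb]

theorem oddsSum_eq_add {p : ℕ → ℝ} {n k : ℕ} (h : k < n) :
    oddsSum p n k = p (k + 1) / (1 - p (k + 1)) + oddsSum p n (k + 1) := by
  rw [oddsSum, Ioc_eq_insert_succ h, Finset.sum_insert (by simp), oddsSum]

theorem noSuccessProb_nonneg {p : ℕ → ℝ} (hp : ∀ j, 1 ≤ j → p j ≤ 1) (n k : ℕ) :
    0 ≤ noSuccessProb p n k :=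
  Finset.prod_nonneg fun j hj => sub_nonneg.2 (hp j (by simp at hj; omega))

theorem noSuccessProb_mono {p : ℕ → ℝ} (hp0 : ∀ j, 1 ≤ j → 0 ≤ p j) (hp : ∀ j, 1 ≤ j → p j ≤ 1)
    (n : ℕ) : Monotone (noSuccessProb p n) := by
  refine monotone_nat_of_le_succ fun k => ?_
  rcases lt_or_ge k n with h | h
  · rw [noSuccessProb_eq_mul h]
    have := noSuccessProb_nonneg hp n (k + 1)
    nlinarith [hp0 (k + 1) (by omega)]
  · rw [noSuccessProb, noSuccessProb, Finset.Ioc_eq_empty (by omega),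
      Finset.Ioc_eq_empty (by omega)]

theorem profile_pos {θ : ℝ} (hθ : 0 < θ) {k : ℕ} (hk : 1 ≤ k) : 0 < profile θ k := by
  have : (1 : ℝ) ≤ k := by exact_mod_cast hk
  exact div_pos hθ (by linarith)

theorem profile_le_one {θ : ℝ} (hθ : 0 < θ) {k : ℕ} (hk : 1 ≤ k) : profile θ k ≤ 1 := by
  have : (1 : ℝ) ≤ k := by exact_mod_cast hk
  exact (div_le_one (by linarith)).2 (by linarith)

theorem profile_lt_one {θ : ℝ} (hθ : 0 < θ) {k : ℕ} (hk : 2 ≤ k) : profile θ k < 1 := by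
  have : (2 : ℝ) ≤ k := by exact_mod_cast hk
  exact (div_lt_one (by linarith)).2 (by linarith)

/-- This makes odds sums `θ` times harmonic sums, comparable with `θ log`. Trial `1` is left out:
its success probability is `1`, and its odds are `0` by the convention for division by zero. -/
theorem odds_profile {θ : ℝ} (hθ : 0 < θ) {i : ℕ} (hi : 1 ≤ i) :
    profile θ (i + 1) / (1 - profile θ (i + 1)) = θ / i := by
  have : (1 : ℝ) ≤ i := by exact_mod_cast hi
  have h1 : θ + ((i + 1 : ℕ) : ℝ) - 1 = θ + i := by push_cast; ring
  rw [profile, h1]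
  have : θ + (i : ℝ) ≠ 0 := by positivity
  have : (i : ℝ) ≠ 0 := by positivity
  have : 1 - θ / (θ + i) = i / (θ + i) := by field_simp; ring
  rw [this]; field_simp

theorem log_succ_sub_log_le {i : ℕ} (hi : 1 ≤ i) : Real.log (i + 1) - Real.log i ≤ 1 / i := by
  have : (1 : ℝ) ≤ i := by exact_mod_cast hi
  rw [← Real.log_div (by positivity) (by positivity)]
  refine (Real.log_le_sub_one_of_pos (by positivity)).trans (le_of_eq ?_)
  field_simp; ring

theorem inv_le_log_sub_log {i : ℕ} (hi : 2 ≤ i) : 1 / i ≤ Real.log i - Real.log (i - 1) := by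
  have : (2 : ℝ) ≤ i := by exact_mod_cast hi
  have h1 : (0 : ℝ) < i - 1 := by linarith
  rw [← Real.log_div (by positivity) h1.ne']
  refine le_trans (le_of_eq ?_) (Real.one_sub_inv_le_log_of_pos (by positivity))
  field_simp; ring

theorem le_oddsSum_profile {θ : ℝ} (hθ : 0 < θ) {m : ℕ} (hm : 1 ≤ m) {n : ℕ} (h : m ≤ n) :
    θ * (Real.log n - Real.log m) ≤ oddsSum (profile θ) n m := by
  induction n, h using Nat.le_induction with
  | base => simp [oddsSum]
  | succ n hn ih =>
    have h1 : Finset.Ioc m (n + 1) = insert (n + 1) (Finset.Ioc m n) := by ext; simp; omega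
    rw [oddsSum] at ih ⊢
    rw [h1, Finset.sum_insert (by simp), odds_profile hθ (hm.trans hn)]
    have := mul_le_mul_of_nonneg_left (log_succ_sub_log_le (hm.trans hn)) hθ.le
    rw [mul_one_div] at this
    push_cast
    linarith

theorem oddsSum_profile_le {θ : ℝ} (hθ : 0 < θ) {m : ℕ} (hm : 2 ≤ m) {n : ℕ} (h : m ≤ n) :
    oddsSum (profile θ) n m ≤ θ * (Real.log (n - 1) - Real.log (m - 1)) := by
  induction n, h using Nat.le_induction with
  | base => simp [oddsSum]
  | succ n hn ih =>
    have h1 : Finset.Ioc m (n + 1) = insert (n + 1) (Finset.Ioc m n) := by ext; simp; omega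
    rw [oddsSum] at ih ⊢
    rw [h1, Finset.sum_insert (by simp), odds_profile hθ (by omega)]
    have := mul_le_mul_of_nonneg_left (inv_le_log_sub_log (hm.trans hn)) hθ.le
    rw [mul_one_div] at this
    push_cast
    rw [add_sub_cancel_right]
    linarith

/-! ### Asymptotic values for a known number of trials. -/

/-- The odds-theorem potential: for large `n` the value of the last-success problem with `n`
trials is at most `e⁻¹ + ε`. -/
theorem exists_potential {θ : ℝ} (hθ : 0 < θ) {ε : ℝ} (hε : 0 < ε) :
    ∃ n₀ : ℕ, ∀ n, n₀ ≤ n → ∃ V : ℕ → ℝ, (∀ k, k < n → V (k + 1) ≤ V k) ∧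
      (∀ k, k < n → V (k + 1) + profile θ (k + 1) *
        (noSuccessProb (profile θ) n (k + 1) - V (k + 1)) ≤ V k) ∧
      0 ≤ V n ∧ V 0 ≤ Real.exp (-1) + ε := by
  obtain ⟨η, hη0, hη1, hη⟩ : ∃ η : ℝ, 0 < η ∧ η < 1 ∧
      Real.exp (-1) ≤ (Real.exp (-1) + ε) * (1 - η) := by
    have he := Real.exp_pos (-1)
    refine ⟨ε / (Real.exp (-1) + ε), by positivity, ?_, le_of_eq ?_⟩
    · rw [div_lt_one (by positivity)]; linarith
    · field_simp; ring
  obtain ⟨K, hK⟩ := exists_nat_ge (θ / η + 1)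
  have hK1 : (1 : ℝ) ≤ K := by have : 0 < θ / η := by positivity
                               linarith
  have hK1' : 1 ≤ K := by exact_mod_cast hK1
  have hpη : ∀ j, K < j → profile θ j ≤ η := by
    intro j hj
    have : (K : ℝ) + 1 ≤ j := by exact_mod_cast hj
    have h2 : θ / η ≤ θ + j - 1 := by linarith
    rw [div_le_iff₀ hη0] at h2
    rw [profile, div_le_iff₀ (by linarith)]
    linarith
  have hlog : Tendsto (fun n : ℕ => θ * (Real.log n - Real.log K)) atTop atTop :=
    (tendsto_atTop_add_const_right _ _
      (Real.tendsto_log_atTop.comp tendsto_natCast_atTop_atTop)).const_mul_atTop hθ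
  obtain ⟨n₁, hn₁⟩ := eventually_atTop.1 (hlog.eventually_ge_atTop 1)
  refine ⟨max n₁ K, fun n hn => ?_⟩
  set p := profile θ with hp
  have hKn : K ≤ n := (le_max_right _ _).trans hn
  have hOK : 1 ≤ oddsSum p n K :=
    (hn₁ n ((le_max_left _ _).trans hn)).trans (le_oddsSum_profile hθ hK1' hKn)
  classical
  -- The odds threshold: the last index after which the odds still sum to at least `1`. Since `1 ≤ K
  -- ≤ M`, trial `1` is avoided and all later `p j` are at most `η`.
  set M := Nat.findGreatest (fun k => 1 ≤ oddsSum p n k) n with hM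
  have hKM : K ≤ M := Nat.le_findGreatest hKn hOK
  have hOM : 1 ≤ oddsSum p n M := Nat.findGreatest_spec (P := fun k => 1 ≤ oddsSum p n k) hKn hOK
  have hMn : M ≤ n := Nat.findGreatest_le n
  have hgt : ∀ k, M < k → k ≤ n → oddsSum p n k < 1 := fun k h1 h2 =>
    not_le.1 (Nat.findGreatest_is_greatest (P := fun k => 1 ≤ oddsSum p n k) h1 h2)
  have hp0 : ∀ j, 1 ≤ j → 0 ≤ p j := fun j hj => (profile_pos hθ hj).le
  have hp1 : ∀ j, 1 ≤ j → p j ≤ 1 := fun j hj => profile_le_one hθ hj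
  have hr0 := noSuccessProb_nonneg hp1 n
  have hrm := noSuccessProb_mono hp0 hp1 n
  have hOn : oddsSum p n n = 0 := by simp [oddsSum]
  have hMlt : M < n := by
    refine lt_of_le_of_ne hMn fun h => ?_
    rw [h, hOn] at hOM; linarith
  have step : ∀ k, M ≤ k → k < n →
      noSuccessProb p n k * oddsSum p n k = noSuccessProb p n (k + 1) * oddsSum p n (k + 1)
        + p (k + 1) * (noSuccessProb p n (k + 1)
          - noSuccessProb p n (k + 1) * oddsSum p n (k + 1)) := by
    intro k h1 h2
    have h3 : 1 - p (k + 1) ≠ 0 := (sub_pos.2 (profile_lt_one hθ (by omega))).ne'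
    rw [noSuccessProb_eq_mul h2, oddsSum_eq_add h2]
    field_simp
    ring
  -- The probability of exactly one success after index `max k M`, which is the value of accepting
  -- the first success after that index.
  refine ⟨fun k => noSuccessProb p n (max k M) * oddsSum p n (max k M), ?_, ?_, ?_, ?_⟩
  · intro k hk
    rcases lt_or_ge k M with h | h
    · simp only [max_eq_right h.le, max_eq_right (Nat.succ_le_of_lt h), le_refl]
    · simp only [max_eq_left h, max_eq_left (h.trans (Nat.le_succ k))]
      rw [step k h hk]
      have := mul_nonneg (hp0 (k + 1) (by omega))
        (mul_nonneg (hr0 (k + 1)) (sub_nonneg.2 (hgt (k + 1) (by omega) hk).le))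
      linarith
  · intro k hk
    rcases lt_or_ge k M with h | h
    · simp only [max_eq_right h.le, max_eq_right (Nat.succ_le_of_lt h)]
      have h1 := hrm (Nat.succ_le_of_lt h)
      have h2 := mul_le_mul_of_nonneg_left hOM (hr0 M)
      have := mul_nonneg (hp0 (k + 1) (by omega))
        (by linarith : 0 ≤ noSuccessProb p n M * oddsSum p n M - noSuccessProb p n (k + 1))
      linarith
    · simp only [max_eq_left h, max_eq_left (h.trans (Nat.le_succ k))]
      rw [step k h hk]
  · simp [max_eq_left hMn, hOn]
  · simp only [Nat.zero_le, max_eq_right]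
    have h1 : noSuccessProb p n M ≤ Real.exp (-((1 - η) * oddsSum p n M)) := by
      rw [noSuccessProb, oddsSum, Finset.mul_sum, ← Finset.sum_neg_distrib, Real.exp_sum]
      refine Finset.prod_le_prod (fun j hj => ?_) fun j hj => ?_
      · simp at hj; exact sub_nonneg.2 (hp1 j (by omega))
      · have hj' : M < j := by simp at hj; omega
        have h3 : 0 < 1 - p j := sub_pos.2 (profile_lt_one hθ (by omega))
        have h4 : (1 - η) * (p j / (1 - p j)) ≤ p j := by
          rw [← mul_div_assoc, div_le_iff₀ h3, mul_comm]
          exact mul_le_mul_of_nonneg_left (by linarith [hpη j (by omega)]) (hp0 j (by omega))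
        have := Real.add_one_le_exp (-((1 - η) * (p j / (1 - p j))))
        linarith
    -- The inequality `x * exp (-x) ≤ exp (-1)` makes it unnecessary to estimate how close the odds
    -- sum at `M` is to `1`.
    have h2 : (1 - η) * oddsSum p n M * Real.exp (-((1 - η) * oddsSum p n M)) ≤ Real.exp (-1) := by
      set x := (1 - η) * oddsSum p n M
      have h3 := Real.add_one_le_exp (x - 1)
      calc x * Real.exp (-x) ≤ Real.exp (x - 1) * Real.exp (-x) := by
            gcongr; linarith
        _ = Real.exp (-1) := by rw [← Real.exp_add]; congr 1; ring
    have h3 := mul_le_mul_of_nonneg_right h1 (by linarith : 0 ≤ oddsSum p n M)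
    have h4 : 0 < 1 - η := by linarith
    refine le_of_mul_le_mul_right ?_ h4
    nlinarith

/-- Asymptotic lower bound for the probability of a single success among the late trials. -/
theorem exists_window {θ : ℝ} (hθ : 0 < θ) {ε : ℝ} (hε : 0 < ε) :
    ∃ δ : ℝ, 0 < δ ∧ 0 < Real.exp (-1 / θ) - 2 * δ ∧ Real.exp (-1 / θ) + 2 * δ < 1 ∧
      ∃ n₀ : ℕ, ∀ n : ℕ, n₀ ≤ n →
        1 ≤ ⌊(Real.exp (-1 / θ) - 2 * δ) * n⌋₊ ∧
        Real.exp (-1) - ε ≤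
          noSuccessProb (profile θ) n ⌊(Real.exp (-1 / θ) - 2 * δ) * n⌋₊ *
          oddsSum (profile θ) n ⌈(Real.exp (-1 / θ) + 2 * δ) * n⌉₊ := by
  set c := Real.exp (-1 / θ) with hc
  have hc0 : 0 < c := Real.exp_pos _
  have hc1 : c < 1 := by
    rw [hc, Real.exp_lt_one_iff, neg_div, neg_lt_zero]; positivity
  have hlogc : Real.log c = -1 / θ := Real.log_exp _
  -- The limiting lower bound as a function of the window width. At width `0` it equals `e⁻¹`; the
  -- step from `2 * δ` to `3 * δ` absorbs rounding.
  have hcont : ContinuousAt (fun x : ℝ => Real.exp (θ * Real.log (c - 3 * x)) *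
      (θ * -Real.log (c + 3 * x))) 0 := by
    have h1 : c - 3 * 0 ≠ 0 := by simpa using hc0.ne'
    have h2 : c + 3 * 0 ≠ 0 := by simpa using hc0.ne'
    fun_prop (disch := assumption)
  have hval : Real.exp (θ * Real.log (c - 3 * 0)) * (θ * -Real.log (c + 3 * 0))
      = Real.exp (-1) := by
    have h1 : θ * (-1 / θ) = -1 := by field_simp
    have h2 : θ * -(-1 / θ) = 1 := by field_simp
    rw [mul_zero, sub_zero, add_zero, hlogc, h1, h2, mul_one]
  have hev : ∀ᶠ x : ℝ in 𝓝[>] 0, Real.exp (-1) - ε < Real.exp (θ * Real.log (c - 3 * x)) *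
      (θ * -Real.log (c + 3 * x)) := by
    refine (hcont.eventually_const_lt ?_).filter_mono nhdsWithin_le_nhds
    simp only [hval]; linarith
  have hev1 : ∀ᶠ x : ℝ in 𝓝[>] 0, x < c / 3 :=
    (eventually_lt_nhds (by positivity)).filter_mono nhdsWithin_le_nhds
  have hev2 : ∀ᶠ x : ℝ in 𝓝[>] 0, x < (1 - c) / 3 :=
    (eventually_lt_nhds (by linarith)).filter_mono nhdsWithin_le_nhds
  obtain ⟨δ, hδ, hδ1, hδ2, hδ0⟩ :=
    (hev.and (hev1.and (hev2.and eventually_mem_nhdsWithin))).exists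
  have hδ0 : 0 < δ := hδ0
  have hδ3 : 0 < c - 3 * δ := by linarith
  obtain ⟨n₀, hn₀⟩ := exists_nat_ge (2 / δ + 2 / (c - 3 * δ))
  refine ⟨δ, hδ0, by linarith, by linarith, n₀, fun n hn => ?_⟩
  have hnR : 2 / δ + 2 / (c - 3 * δ) ≤ n := hn₀.trans (by exact_mod_cast hn)
  have hn1 : 2 ≤ δ * n := by
    have : 2 / δ ≤ n := by have : 0 < 2 / (c - 3 * δ) := by positivity
                           linarith
    rwa [div_le_iff₀ hδ0, mul_comm] at this
  have hn2 : 2 ≤ (c - 3 * δ) * n := by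
    have : 2 / (c - 3 * δ) ≤ n := by have : 0 < 2 / δ := by positivity
                                     linarith
    rwa [div_le_iff₀ hδ3, mul_comm] at this
  have hn0 : (0 : ℝ) < n := by
    by_contra h
    nlinarith
  set m₁ := ⌊(c - 2 * δ) * n⌋₊ with hm₁
  set m₂ := ⌈(c + 2 * δ) * n⌉₊ with hm₂
  have hm₁lo : (c - 3 * δ) * n ≤ m₁ - 1 := by
    have := Nat.lt_floor_add_one ((c - 2 * δ) * n)
    rw [← hm₁] at this
    linarith
  have hm₁hi : (m₁ : ℝ) ≤ (c - 2 * δ) * n := Nat.floor_le (by nlinarith)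
  have hm₂lo : (c + 2 * δ) * n ≤ m₂ := Nat.le_ceil _
  have hm₂hi : (m₂ : ℝ) ≤ (c + 3 * δ) * n := by
    have := Nat.ceil_lt_add_one (a := (c + 2 * δ) * n) (by nlinarith)
    rw [← hm₂] at this
    linarith
  have hm₁2 : 2 ≤ m₁ := by
    have : (2 : ℝ) ≤ m₁ := by linarith
    exact_mod_cast this
  have hm₁n : m₁ ≤ n := by
    have : (m₁ : ℝ) ≤ n := by nlinarith
    exact_mod_cast this
  have hm₂n : m₂ ≤ n := by
    have : (m₂ : ℝ) ≤ n := by nlinarith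
    exact_mod_cast this
  have hm₂0 : (0 : ℝ) < m₂ := lt_of_lt_of_le (by positivity) hm₂lo
  have hm₂1 : 1 ≤ m₂ := by exact_mod_cast hm₂0
  refine ⟨by omega, hδ.le.trans ?_⟩
  refine mul_le_mul ?_ ?_ ?_ (noSuccessProb_nonneg (fun j hj => profile_le_one hθ hj) _ _)
  · have h1 : Real.exp (-oddsSum (profile θ) n m₁) ≤ noSuccessProb (profile θ) n m₁ := by
      rw [noSuccessProb, oddsSum, ← Finset.sum_neg_distrib, Real.exp_sum]
      refine Finset.prod_le_prod (fun j hj => (Real.exp_pos _).le) fun j hj => ?_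
      have hj' : m₁ < j := by simp at hj; omega
      have h3 : 0 < 1 - profile θ j := sub_pos.2 (profile_lt_one hθ (by omega))
      have h4 := Real.add_one_le_exp (profile θ j / (1 - profile θ j))
      rw [Real.exp_neg]
      have h5 : profile θ j / (1 - profile θ j) + 1 = (1 - profile θ j)⁻¹ := by
        field_simp; ring
      rw [h5] at h4
      exact inv_le_of_inv_le₀ h3 h4
    refine le_trans (Real.exp_le_exp.2 ?_) h1
    have h2 := oddsSum_profile_le hθ hm₁2 hm₁n
    have h3 : Real.log (c - 3 * δ) + Real.log n ≤ Real.log (m₁ - 1) := by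
      rw [← Real.log_mul hδ3.ne' hn0.ne']
      exact Real.log_le_log (by positivity) hm₁lo
    have h4 : Real.log (n - 1) ≤ Real.log n := by
      refine Real.log_le_log ?_ (by linarith)
      have : (2 : ℝ) ≤ n := by exact_mod_cast hm₁2.trans hm₁n
      linarith
    nlinarith
  · refine le_trans ?_ (le_oddsSum_profile hθ hm₂1 hm₂n)
    have h3 : Real.log m₂ ≤ Real.log (c + 3 * δ) + Real.log n := by
      rw [← Real.log_mul (by positivity) hn0.ne']
      exact Real.log_le_log hm₂0 hm₂hi
    exact mul_le_mul_of_nonneg_left (by linarith) hθ.le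
  · have : Real.log (c + 3 * δ) ≤ 0 := Real.log_nonpos (by positivity) (by linarith)
    exact mul_nonneg hθ.le (by linarith)

/-! ### Epochs, counts and adaptedness of cutoff strategies. -/

namespace Model

variable {Ω : Type*} [MeasurableSpace Ω] {μ : Measure Ω} {p : ℕ → ℝ} (M : Model μ p)

theorem count_mono {s t : ℝ} (h : s ≤ t) (ω : Ω) : M.count s ω ≤ M.count t ω :=
  Finset.card_le_card fun n hn => by
    simp only [Finset.mem_filter] at hn ⊢
    exact ⟨hn.1, hn.2.trans h⟩

theorem count_le_N (t : ℝ) (ω : Ω) : M.count t ω ≤ M.N ω :=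
  (Finset.card_filter_le _ _).trans (by simp)

theorem eventually_count_eq (t : ℝ) (ω : Ω) : ∀ᶠ s in 𝓝[>] t, M.count s ω = M.count t ω := by
  have h : ∀ᶠ s in 𝓝[>] t, ∀ n ∈ Finset.Icc 1 (M.N ω), (M.U n ω ≤ s ↔ M.U n ω ≤ t) := by
    rw [Filter.eventually_all_finset]
    intro n _
    rcases le_or_gt (M.U n ω) t with h | h
    · filter_upwards [eventually_mem_nhdsWithin] with s hs
      exact ⟨fun _ => h, fun _ => h.trans (le_of_lt hs)⟩
    · filter_upwards [(eventually_lt_nhds h).filter_mono nhdsWithin_le_nhds] with s hs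
      exact ⟨fun h' => absurd h' (not_le.2 hs), fun h' => absurd h' (not_le.2 h)⟩
  filter_upwards [h] with s hs
  exact congrArg Finset.card (Finset.filter_congr hs)

theorem exists_count_eq_N (ω : Ω) : ∃ t, M.count t ω = M.N ω := by
  obtain ⟨t, ht⟩ := ((Finset.Icc 1 (M.N ω)).image fun n => M.U n ω).exists_le
  refine ⟨t, ?_⟩
  rw [count, Finset.filter_true_of_mem fun n hn => ht _ (Finset.mem_image_of_mem _ hn)]
  simp

theorem exists_count_eq_zero (ω : Ω) : ∃ t, M.count t ω = 0 := by
  obtain ⟨t, ht⟩ := ((Finset.Icc 1 (M.N ω)).image fun n => M.U n ω).bddBelow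
  refine ⟨t - 1, ?_⟩
  rw [count, Finset.card_eq_zero, Finset.filter_eq_empty_iff]
  intro n hn h
  have := ht (Finset.mem_coe.2 (Finset.mem_image_of_mem (fun n => M.U n ω) hn))
  linarith

/-- Right-continuity of the count makes the infimum attained. The bounds on `k` ensure that the set
is bounded below and nonempty. -/
theorem epoch_le_iff {k : ℕ} {ω : Ω} (hk : 1 ≤ k) (hkN : k ≤ M.N ω) {t : ℝ} :
    M.epoch k ω ≤ t ↔ k ≤ M.count t ω := by
  obtain ⟨t₁, ht₁⟩ := M.exists_count_eq_N ω
  obtain ⟨t₀, ht₀⟩ := M.exists_count_eq_zero ω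
  have hne : {t : ℝ | k ≤ M.count t ω}.Nonempty := ⟨t₁, by simpa [ht₁] using hkN⟩
  have hbdd : BddBelow {t : ℝ | k ≤ M.count t ω} := by
    refine ⟨t₀, fun s hs => ?_⟩
    by_contra h
    have := M.count_mono (not_le.1 h).le ω
    simp only [Set.mem_ofPred_eq] at hs
    omega
  have hmem : k ≤ M.count (M.epoch k ω) ω := by
    obtain ⟨u, hu, hu'⟩ :=
      mem_nhdsGT_iff_exists_Ioo_subset.1 (M.eventually_count_eq (M.epoch k ω) ω)
    obtain ⟨s, hs, hsu⟩ := (csInf_lt_iff hbdd hne).1 (show sInf {t | k ≤ M.count t ω} < u from hu)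
    rcases (show M.epoch k ω ≤ s from csInf_le hbdd hs).eq_or_lt with h | h
    · rw [h]; exact hs
    · have h2 : M.count s ω = M.count (M.epoch k ω) ω := hu' ⟨h, hsu⟩
      rw [← h2]; exact hs
  exact ⟨fun h => hmem.trans (M.count_mono h ω), fun h => csInf_le hbdd h⟩

theorem measurableSet_observed_count {s t : ℝ} (hs : s ∈ Set.Icc 0 t) (S : Set ℕ) :
    MeasurableSet[M.observed t] {ω | M.count s ω ∈ S} := by
  have h : {ω | M.count s ω ∈ S} = ⋃ k ∈ S, {ω | M.count s ω = k} := by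
    ext ω; simp
  rw [h]
  exact .biUnion S.to_countable fun k _ =>
    MeasurableSpace.measurableSet_generateFrom (Or.inl ⟨s, hs, k, rfl⟩)

theorem measurableSet_observed_success {s t : ℝ} (hs : s ∈ Set.Icc 0 t) {k : ℕ} (hk : 1 ≤ k) :
    MeasurableSet[M.observed t] {ω | k ≤ M.count s ω ∧ M.X k ω = true} :=
  MeasurableSpace.measurableSet_generateFrom (Or.inr ⟨s, hs, k, hk, rfl⟩)

theorem markov_eq_one_or (B : Set (ℝ × ℕ)) (ω : Ω) :
    (M.markov B ω = 1 ∧ ∀ k, M.IsSuccess k ω → (M.epoch k ω, k) ∉ B) ∨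
    ∃ k, M.IsSuccess k ω ∧ (M.epoch k ω, k) ∈ B ∧ M.markov B ω = M.epoch k ω ∧
      ∀ j, M.IsSuccess j ω → (M.epoch j ω, j) ∈ B → k ≤ j := by
  by_cases h : ∃ k, M.IsSuccess k ω ∧ (M.epoch k ω, k) ∈ B
  · have h1 := Nat.sInf_mem (s := {k | M.IsSuccess k ω ∧ (M.epoch k ω, k) ∈ B}) h
    exact Or.inr ⟨_, h1.1, h1.2, by rw [markov, if_pos h], fun j hj hj' => Nat.sInf_le ⟨hj, hj'⟩⟩
  · refine Or.inl ⟨by rw [markov, if_neg h], fun k hk hk' => h ⟨k, hk, hk'⟩⟩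

theorem epoch_mono {j k : ℕ} {ω : Ω} (hj : 1 ≤ j) (hjk : j ≤ k) (hk : k ≤ M.N ω) :
    M.epoch j ω ≤ M.epoch k ω :=
  (M.epoch_le_iff hj (hjk.trans hk)).2
    (hjk.trans ((M.epoch_le_iff (hj.trans hjk) hk).1 le_rfl))

/-- Cutoff strategies with positive cutoffs are nonanticipating. -/
theorem isStrategy_markov_cutoffSet {b : ℕ → ℝ} (hb : ∀ k, 1 ≤ k → 0 < b k) :
    M.IsStrategy (M.markov (cutoffSet b)) := by
  refine ⟨fun ω => ?_, fun t ht => ?_⟩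
  · rcases M.markov_eq_one_or (cutoffSet b) ω with h | ⟨k, hk, -, hk', -⟩
    exacts [Or.inl h.1, Or.inr ⟨k, hk, hk'⟩]
  rcases ht.2.eq_or_lt with rfl | ht1
  · have : {ω | M.markov (cutoffSet b) ω ≤ 1} = Set.univ := by
      refine Set.eq_univ_of_forall fun ω => ?_
      rcases M.markov_eq_one_or (cutoffSet b) ω with h | ⟨k, hk, hkB, hk', -⟩
      · exact h.1.le
      · simp only [Set.mem_ofPred_eq, hk']
        exact hkB.2.2.le
    rw [this]
    exact MeasurableSet.univ
  -- The condition `b k ≤ T_k` is tested at rational times `q < b k ≤ t` only, so it is already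
  -- observed at `t`. Positivity of `b k` supplies a nonnegative such `q` even if `T_k` is negative
  -- on a null set.
  have key : {ω | M.markov (cutoffSet b) ω ≤ t} = ⋃ k ∈ {k : ℕ | 1 ≤ k ∧ b k ≤ t},
      {ω | k ≤ M.count t ω ∧ M.X k ω = true} \
        ⋃ q ∈ {q : ℚ | 0 ≤ (q : ℝ) ∧ (q : ℝ) < b k}, {ω | M.count q ω ∈ Set.Ici k} := by
    ext ω
    simp only [Set.mem_ofPred_eq, Set.mem_iUnion, Set.mem_sdiff, Set.mem_Ici, exists_prop, not_exists,
      not_and, and_imp]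
    constructor
    · intro h
      rcases M.markov_eq_one_or (cutoffSet b) ω with h' | ⟨k, hk, hkB, hk', -⟩
      · rw [h'.1] at h; linarith
      · rw [hk'] at h
        refine ⟨k, ⟨hk.1, hkB.2.1.trans h⟩, ⟨(M.epoch_le_iff hk.1 hk.2.1).1 h, hk.2.2⟩, ?_⟩
        intro q _ hqb hc
        have := (M.epoch_le_iff hk.1 hk.2.1).2 hc
        have := hkB.2.1
        simp only at this
        linarith
    · rintro ⟨k, ⟨hk1, hbt⟩, ⟨hkt, hX⟩, hq⟩
      have hkN : k ≤ M.N ω := hkt.trans (M.count_le_N t ω)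
      have hkS : M.IsSuccess k ω := ⟨hk1, hkN, hX⟩
      have hTt := (M.epoch_le_iff hk1 hkN).2 hkt
      have hbT : b k ≤ M.epoch k ω := by
        by_contra hlt
        obtain ⟨q, hq1, hq2⟩ := exists_rat_btwn (max_lt (not_le.1 hlt) (hb k hk1))
        exact hq q ((le_max_right _ _).trans hq1.le) hq2
          ((M.epoch_le_iff hk1 hkN).1 ((le_max_left _ _).trans hq1.le))
      have hkB : (M.epoch k ω, k) ∈ cutoffSet b := ⟨hk1, hbT, hTt.trans_lt ht1⟩
      rcases M.markov_eq_one_or (cutoffSet b) ω with h' | ⟨j, hj, -, hj', hmin⟩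
      · exact absurd hkB (h'.2 k hkS)
      · rw [hj']
        exact (M.epoch_mono hj.1 (hmin k hkS hkB) hkN).trans hTt
  rw [key]
  refine .biUnion (Set.to_countable _) fun k hk => .diff
    (M.measurableSet_observed_success ⟨ht.1, le_rfl⟩ hk.1)
    (.biUnion (Set.to_countable _) fun q hq => M.measurableSet_observed_count ⟨hq.1, ?_⟩ _)
  exact hq.2.le.trans hk.2

end Model

/-! ### Independence of later outcomes from the past. -/

theorem indepFun_prodMk_left_of_indepFun {Ω α β γ : Type*} [MeasurableSpace Ω]
    [MeasurableSpace α] [MeasurableSpace β] [MeasurableSpace γ] {μ : Measure Ω} [IsFiniteMeasure μ]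
    {f : Ω → α} {g : Ω → β} {h : Ω → γ} (hf : Measurable f) (hg : Measurable g) (hh : Measurable h)
    (h1 : IndepFun f (fun ω => (g ω, h ω)) μ) (h2 : IndepFun g h μ) :
    IndepFun (fun ω => (f ω, g ω)) h μ := by
  have hfg : IndepFun f g μ := h1.comp measurable_id measurable_fst
  rw [indepFun_iff_map_prod_eq_prod_map_map (by fun_prop) (by fun_prop)] at h1 h2 hfg ⊢
  rw [hfg]
  apply (MeasurableEquiv.prodAssoc (α := α) (β := β) (γ := γ)).map_measurableEquiv_injective
  rw [Measure.prodAssoc_prod, ← h2, ← h1,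
    Measure.map_map (MeasurableEquiv.measurable _) (by fun_prop)]
  rfl

namespace Model

variable {Ω : Type*} [MeasurableSpace Ω] {μ : Measure Ω} {p : ℕ → ℝ} (M : Model μ p)

/-- The number of trials, all the positions, and the outcomes up to index `k`. -/
def pastMap (k : ℕ) (ω : Ω) : (ℕ × (ℕ → ℝ)) × (Finset.Iic k → Bool) :=
  ((M.N ω, fun n => M.U n ω), fun j => M.X j ω)

/-- The σ-algebra generated by the number of trials, all the positions, and the outcomes up to
index `k`. -/
@[reducible] def past (k : ℕ) : MeasurableSpace Ω := MeasurableSpace.comap (M.pastMap k) inferInstance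

theorem measurable_pastMap (k : ℕ) : Measurable (M.pastMap k) :=
  (M.measurable_N.prodMk (measurable_pi_lambda _ M.measurable_U)).prodMk
    (measurable_pi_lambda _ fun j => M.measurable_X j)

theorem past_le (k : ℕ) : M.past k ≤ ‹MeasurableSpace Ω› := (M.measurable_pastMap k).comap_le

theorem measurable_past_N (k : ℕ) : Measurable[M.past k] M.N :=
  measurable_fst.comp (measurable_fst.comp (comap_measurable (M.pastMap k)))

theorem measurable_past_X {j k : ℕ} (h : j ≤ k) : Measurable[M.past k] (M.X j) :=
  (measurable_pi_apply (⟨j, Finset.mem_Iic.2 h⟩ : Finset.Iic k)).comp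
    (measurable_snd.comp (comap_measurable (M.pastMap k)))

theorem past_mono {j k : ℕ} (h : j ≤ k) : M.past j ≤ M.past k := by
  have hφ : Measurable fun x : (ℕ × (ℕ → ℝ)) × (Finset.Iic k → Bool) =>
      (x.1, fun i : Finset.Iic j =>
        x.2 ⟨i, Finset.mem_Iic.2 ((Finset.mem_Iic.1 i.2).trans h)⟩) := by
    fun_prop
  exact (hφ.comp (comap_measurable (M.pastMap k))).comap_le

theorem indepFun_N_U_X [IsFiniteMeasure μ] :
    IndepFun (fun ω => (M.N ω, fun n => M.U n ω)) (fun ω k => M.X k ω) μ :=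
  indepFun_prodMk_left_of_indepFun M.measurable_N (measurable_pi_lambda _ M.measurable_U)
    (measurable_pi_lambda _ M.measurable_X) M.indep_N M.indep_U_X

/-- The pair of `N` and all positions is independent of all outcomes, and the outcomes are mutually
independent; regrouping gives independence of `past k` from the outcomes beyond `k`. -/
theorem measure_past_inter [IsFiniteMeasure μ] {k : ℕ} {A : Set Ω} (hA : MeasurableSet[M.past k] A)
    {T : Finset ℕ} (hT : ∀ j ∈ T, k < j) (S : ℕ → Set Bool) :
    μ.real (A ∩ ⋂ j ∈ T, M.X j ⁻¹' S j) = μ.real A * ∏ j ∈ T, μ.real (M.X j ⁻¹' S j) := by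
  have hdis : Disjoint (Finset.Iic k) T := by
    rw [Finset.disjoint_left]
    intro j hj hjT
    have := hT j hjT
    simp at hj; omega
  have hX := M.indep_X.indepFun_finset (Finset.Iic k) T hdis M.measurable_X
  have hNU : IndepFun (fun ω => (M.N ω, fun n => M.U n ω))
      (fun ω => ((fun j : Finset.Iic k => M.X j ω), fun j : T => M.X j ω)) μ :=
    M.indepFun_N_U_X.comp (ψ := fun x : ℕ → Bool =>
      ((fun j : Finset.Iic k => x j), fun j : T => x j)) measurable_id (by fun_prop)
  have hind : IndepFun (M.pastMap k) (fun ω => fun j : T => M.X j ω) μ :=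
    indepFun_prodMk_left_of_indepFun
      (M.measurable_N.prodMk (measurable_pi_lambda _ M.measurable_U))
      (measurable_pi_lambda _ fun j => M.measurable_X j)
      (measurable_pi_lambda _ fun j => M.measurable_X j) hNU hX
  obtain ⟨A', hA', rfl⟩ := hA
  have hF : (⋂ j ∈ T, M.X j ⁻¹' S j)
      = (fun ω => fun j : T => M.X j ω) ⁻¹' Set.univ.pi fun j : T => S j := by
    ext ω; simp [Set.mem_pi]
  have h1 := hind.measure_inter_preimage_eq_mul A' (Set.univ.pi fun j : T => S j) hA'
    (.univ_pi fun j => .of_discrete)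
  have h2 := M.indep_X.measure_inter_preimage_eq_mul T (sets := S) fun j _ => .of_discrete
  rw [← hF, h2] at h1
  simp only [Measure.real]
  rw [h1, ENNReal.toReal_mul, ENNReal.toReal_prod]

theorem measurable_card_filter_le (t : ℝ) : Measurable fun x : ℕ × (ℕ → ℝ) =>
    ((Finset.Icc 1 x.1).filter (fun n => x.2 n ≤ t)).card := by
  refine measurable_from_prod_countable_right fun n => ?_
  simp only [Finset.card_filter]
  exact Finset.measurable_fun_sum _ fun i _ =>
    Measurable.ite (measurableSet_le (measurable_pi_apply i) measurable_const)
      measurable_const measurable_const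

theorem measurableSet_past_count (k : ℕ) (t : ℝ) (S : Set ℕ) :
    MeasurableSet[M.past k] {ω | M.count t ω ∈ S} :=
  ((measurable_card_filter_le t).comp
    (measurable_fst.comp (comap_measurable (M.pastMap k)))) .of_discrete

/-- When `k` trials have been observed, what has been observed is determined by the positions and
by the first `k` outcomes. -/
theorem measurableSet_past_inter_count {t : ℝ} {A : Set Ω} (hA : MeasurableSet[M.observed t] A)
    (k : ℕ) : MeasurableSet[M.past k] (A ∩ {ω | M.count t ω = k}) := by
  have hC : MeasurableSet[M.past k] {ω | M.count t ω = k} := M.measurableSet_past_count k t {k}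
  induction A, hA using MeasurableSpace.generateFrom_induction with
  | hC A hA _ =>
    rcases hA with ⟨s, hs, j, rfl⟩ | ⟨s, hs, j, hj, rfl⟩
    · exact (M.measurableSet_past_count k s {j}).inter hC
    · rcases le_or_gt j k with h | h
      · exact (((M.measurableSet_past_count k s (Set.Ici j)).inter
          (M.measurable_past_X h (measurableSet_singleton true)))).inter hC
      -- For `j > k`, trial `j` cannot have occurred by `s ≤ t` when only `k` trials have occurred
      -- by `t`.
      · convert MeasurableSet.empty using 1
        ext ω
        simp only [Set.mem_inter_iff, Set.mem_ofPred_eq, Set.mem_empty_iff_false, iff_false]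
        rintro ⟨⟨h1, -⟩, h2⟩
        have := M.count_mono hs.2 ω
        omega
  | empty => simp
  | compl A _ ih =>
    have : Aᶜ ∩ {ω | M.count t ω = k} =
        {ω | M.count t ω = k} \ (A ∩ {ω | M.count t ω = k}) := by
      ext ω; simp; tauto
    rw [this]
    exact hC.diff ih
  | iUnion f _ ih =>
    rw [Set.iUnion_inter]
    exact .iUnion ih

theorem ae_regular [IsProbabilityMeasure μ] : ∀ᵐ ω ∂μ,
    (∀ i, 1 ≤ i → M.U i ω ∈ Set.Ioo 0 1) ∧
    ∀ i j, 1 ≤ i → 1 ≤ j → i ≠ j → M.U i ω ≠ M.U j ω := by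
  refine Filter.Eventually.and ?_ ?_
  · refine ae_all_iff.2 fun i => ?_
    by_cases hi : 1 ≤ i
    · have h : ∀ᵐ x ∂(μ.map (M.U i)), x ∈ Set.Ioo (0 : ℝ) 1 := by
        rw [M.law_U i hi, ← Measure.restrict_congr_set (Ioo_ae_eq_Icc)]
        exact ae_restrict_mem measurableSet_Ioo
      filter_upwards [ae_of_ae_map (M.measurable_U i).aemeasurable h] with ω hω _ using hω
    · exact .of_forall fun ω h => absurd h hi
  · refine ae_all_iff.2 fun i => ae_all_iff.2 fun j => ?_
    by_cases h : 1 ≤ i ∧ 1 ≤ j ∧ i ≠ j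
    · obtain ⟨hi, hj, hij⟩ := h
      have hind := M.indep_U.indepFun hij
      rw [indepFun_iff_map_prod_eq_prod_map_map (M.measurable_U i).aemeasurable
        (M.measurable_U j).aemeasurable, M.law_U i hi, M.law_U j hj] at hind
      have h : ∀ᵐ x ∂(μ.map fun ω => (M.U i ω, M.U j ω)), x.1 ≠ x.2 := by
        rw [hind, Measure.ae_prod_iff_ae_ae (p := fun x : ℝ × ℝ => x.1 ≠ x.2)
          (measurableSet_eq_fun measurable_fst measurable_snd).compl]
        refine .of_forall fun x => ?_
        filter_upwards [Measure.ae_ne _ x] with y hy using hy.symm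
      filter_upwards [ae_of_ae_map
        ((M.measurable_U i).prodMk (M.measurable_U j)).aemeasurable h] with ω hω _ _ _ using hω
    · exact .of_forall fun ω h1 h2 h3 => absurd ⟨h1, h2, h3⟩ h

/-- Without ties the count jumps to exactly `k` at the `k`-th epoch and stays there for a while, so
a rational time detects it. This allows stopping events to be countable unions. -/
theorem exists_rat_count_eq {ω : Ω} (h0 : ∀ i, 1 ≤ i → M.U i ω ∈ Set.Ioo 0 1)
    (hne : ∀ i j, 1 ≤ i → 1 ≤ j → i ≠ j → M.U i ω ≠ M.U j ω)
    {k : ℕ} (hk : 1 ≤ k) (hkN : k ≤ M.N ω) (h1 : M.epoch k ω < 1) :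
    ∃ q : ℚ, 0 ≤ (q : ℝ) ∧ (q : ℝ) < 1 ∧ M.epoch k ω ≤ q ∧ M.count q ω = k := by
  set T := M.epoch k ω with hT
  have hkT : k ≤ M.count T ω := (M.epoch_le_iff hk hkN).1 le_rfl
  have hT0 : 0 ≤ T := by
    have : 0 < M.count T ω := by omega
    obtain ⟨i, hi⟩ := Finset.card_pos.1 this
    simp only [Finset.mem_filter, Finset.mem_Icc] at hi
    exact (h0 i hi.1.1).1.le.trans hi.2
  have hTk : M.count T ω = k := by
    refine le_antisymm ?_ hkT
    by_contra hlt
    -- If the count at `T` exceeded `k`, then, at most one position being equal to `T`, at least `k`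
    -- would lie strictly below `T`, and the `k`-th epoch would be earlier.
    set A := (Finset.Icc 1 (M.N ω)).filter (fun n => M.U n ω < T) with hA
    set E := (Finset.Icc 1 (M.N ω)).filter (fun n => M.U n ω = T) with hE
    have hE1 : E.card ≤ 1 := by
      refine Finset.card_le_one.2 fun i hi j hj => ?_
      simp only [hE, Finset.mem_filter, Finset.mem_Icc] at hi hj
      by_contra hij
      exact hne i j hi.1.1 hj.1.1 hij (hi.2.trans hj.2.symm)
    have hsub : (Finset.Icc 1 (M.N ω)).filter (fun n => M.U n ω ≤ T) ⊆ A ∪ E := by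
      intro i hi
      simp only [hA, hE, Finset.mem_union, Finset.mem_filter] at hi ⊢
      rcases hi.2.lt_or_eq with h | h
      exacts [Or.inl ⟨hi.1, h⟩, Or.inr ⟨hi.1, h⟩]
    have hcard := (Finset.card_le_card hsub).trans (Finset.card_union_le _ _)
    have hcount : M.count T ω ≤ A.card + E.card := hcard
    have hev : ∀ᶠ s in 𝓝[<] T, ∀ i ∈ A, M.U i ω < s := by
      rw [Filter.eventually_all_finset]
      intro i hi
      exact (eventually_gt_nhds (Finset.mem_filter.1 hi).2).filter_mono nhdsWithin_le_nhds
    obtain ⟨s, hs, hsT⟩ := (hev.and eventually_mem_nhdsWithin).exists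
    have hAs : A.card ≤ M.count s ω := Finset.card_le_card fun i hi =>
      Finset.mem_filter.2 ⟨(Finset.mem_filter.1 hi).1, (hs i hi).le⟩
    have : T ≤ s := (M.epoch_le_iff hk hkN).2 (by omega)
    exact absurd hsT (not_lt.2 this)
  obtain ⟨u, hu, hu'⟩ := mem_nhdsGT_iff_exists_Ioo_subset.1 (M.eventually_count_eq T ω)
  obtain ⟨q, hq1, hq2⟩ := exists_rat_btwn (lt_min hu h1 : T < min u 1)
  refine ⟨q, hT0.trans hq1.le, hq2.trans_le (min_le_right _ _), hq1.le, ?_⟩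
  have h2 : M.count q ω = M.count T ω := hu' ⟨hq1, hq2.trans_le (min_le_left _ _)⟩
  rw [h2, hTk]

theorem measureReal_X_true (hp : ∀ k, 1 ≤ k → 0 ≤ p k) {k : ℕ} (hk : 1 ≤ k) :
    μ.real (M.X k ⁻¹' {true}) = p k := by
  have h : μ (M.X k ⁻¹' {true}) = ENNReal.ofReal (p k) := M.law_X k hk
  rw [Measure.real, h, ENNReal.toReal_ofReal (hp k hk)]

theorem measureReal_X_false [IsProbabilityMeasure μ] (hp : ∀ k, 1 ≤ k → 0 ≤ p k) {k : ℕ}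
    (hk : 1 ≤ k) : μ.real (M.X k ⁻¹' {false}) = 1 - p k := by
  rw [← M.measureReal_X_true hp hk, ← probReal_compl_eq_one_sub
    (M.measurable_X k (measurableSet_singleton true))]
  congr 1
  ext ω; simp

/-! ### Upper bound for a fixed number of trials. -/

/-- `τ` has stopped at a time when exactly `k` trials have been observed. -/
def stoppedAt (τ : Ω → ℝ) (k : ℕ) : Set Ω :=
  ⋃ q ∈ {q : ℚ | 0 ≤ (q : ℝ) ∧ (q : ℝ) < 1}, {ω | τ ω ≤ q} ∩ {ω | M.count q ω = k}

/-- There are `n` trials, the `k`-th is a success, and it is the one at which `τ` stops. -/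
def stopAt (τ : Ω → ℝ) (n k : ℕ) : Set Ω :=
  (M.N ⁻¹' {n} ∩ M.X k ⁻¹' {true} ∩ M.stoppedAt τ k) \ ⋃ j ∈ Finset.Ico 1 k, M.stoppedAt τ j

theorem measurableSet_stoppedAt {τ : Ω → ℝ} (hτ : M.IsStrategy τ) (k : ℕ) :
    MeasurableSet[M.past k] (M.stoppedAt τ k) :=
  .biUnion (Set.to_countable _) fun q hq =>
    M.measurableSet_past_inter_count (hτ.2 q ⟨hq.1, hq.2.le⟩) k

theorem measurableSet_stopAt {τ : Ω → ℝ} (hτ : M.IsStrategy τ) (n k : ℕ) :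
    MeasurableSet[M.past k] (M.stopAt τ n k) := by
  refine .diff (.inter (.inter (M.measurable_past_N k .of_discrete)
    (M.measurable_past_X le_rfl .of_discrete)) (M.measurableSet_stoppedAt hτ k)) ?_
  refine Finset.measurableSet_biUnion _ fun j hj => ?_
  exact M.past_mono (Finset.mem_Ico.1 hj).2.le _ (M.measurableSet_stoppedAt hτ j)

theorem disjoint_stopAt {τ : Ω → ℝ} (n : ℕ) {i j : ℕ} (hi : 1 ≤ i) (hij : i < j) :
    Disjoint (M.stopAt τ n i) (M.stopAt τ n j) := by
  rw [Set.disjoint_left]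
  intro ω h1 h2
  exact h2.2 (Set.mem_biUnion (Finset.mem_coe.2 (Finset.mem_Ico.2 ⟨hi, hij⟩)) h1.1.2)

theorem winEvent_subset {τ : Ω → ℝ} {n : ℕ} {ω : Ω}
    (h0 : ∀ i, 1 ≤ i → M.U i ω ∈ Set.Ioo 0 1)
    (hne : ∀ i j, 1 ≤ i → 1 ≤ j → i ≠ j → M.U i ω ≠ M.U j ω)
    (hω : ω ∈ M.winEvent τ ∩ M.N ⁻¹' {n}) :
    ω ∈ ⋃ k ∈ Finset.range n,
      M.stopAt τ n (k + 1) ∩ ⋂ j ∈ Finset.Ioc (k + 1) n, M.X j ⁻¹' {false} := by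
  obtain ⟨⟨hτ1, k, ⟨hk, hkN, hX⟩, hτk, hlast⟩, hN⟩ := hω
  have hN : M.N ω = n := hN
  obtain ⟨k, rfl⟩ : ∃ i, k = i + 1 := ⟨k - 1, by omega⟩
  obtain ⟨q, hq0, hq1, hTq, hqk⟩ := M.exists_rat_count_eq h0 hne hk hkN (hτk ▸ hτ1)
  refine Set.mem_biUnion (x := k) (by simp; omega) ⟨⟨⟨⟨hN, hX⟩, ?_⟩, ?_⟩, ?_⟩
  · exact Set.mem_biUnion (show q ∈ {q : ℚ | 0 ≤ (q : ℝ) ∧ (q : ℝ) < 1} from ⟨hq0, hq1⟩)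
      ⟨hτk.le.trans hTq, hqk⟩
  -- Any time at which `τ` has stopped is at or after the epoch of the winning trial, hence has a
  -- count of at least that trial's index.
  · simp only [stoppedAt, Set.mem_iUnion, not_exists]
    rintro j hj q' - ⟨h1, h2⟩
    have h3 := (M.epoch_le_iff hk hkN).1 (hτk.ge.trans h1)
    have h2 : M.count q' ω = j := h2
    simp only [Finset.mem_Ico] at hj
    omega
  · refine Set.mem_iInter₂.2 fun j hj => ?_
    rw [Finset.mem_Ioc] at hj
    have h4 := hlast j hj.1
    simp only [IsSuccess, not_and, Bool.not_eq_true] at h4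
    exact h4 (by omega) (by omega)

/-- Given `n` trials, no strategy does better than the potential allows. -/
theorem measureReal_winEvent_le [IsProbabilityMeasure μ] (hp0 : ∀ k, 1 ≤ k → 0 ≤ p k)
    {τ : Ω → ℝ} (hτ : M.IsStrategy τ) {n : ℕ} {V : ℕ → ℝ}
    (hV : ∀ k, k < n → V (k + 1) ≤ V k)
    (hVr : ∀ k, k < n → V (k + 1) + p (k + 1) * (noSuccessProb p n (k + 1) - V (k + 1)) ≤ V k)
    (hVn : 0 ≤ V n) :
    μ.real (M.winEvent τ ∩ M.N ⁻¹' {n}) ≤ μ.real (M.N ⁻¹' {n}) * V 0 := by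
  have hmeas : ∀ k, MeasurableSet (M.stopAt τ n k) := fun k =>
    M.past_le k _ (M.measurableSet_stopAt hτ n k)
  have hsub : ∀ k, M.stopAt τ n k ⊆ M.N ⁻¹' {n} := fun k ω hω => hω.1.1.1
  have hdis : ∀ k, (↑(Finset.range k) : Set ℕ).PairwiseDisjoint fun j => M.stopAt τ n (j + 1) := by
    intro k i _ j _ hij
    rcases lt_or_gt_of_ne hij with h | h
    · exact M.disjoint_stopAt n (by omega) (by omega)
    · exact (M.disjoint_stopAt n (by omega) (by omega)).symm
  have hrem : ∀ k, μ.real (M.N ⁻¹' {n} \ ⋃ j ∈ Finset.range k, M.stopAt τ n (j + 1))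
      = μ.real (M.N ⁻¹' {n}) - ∑ j ∈ Finset.range k, μ.real (M.stopAt τ n (j + 1)) := by
    intro k
    rw [measureReal_sdiff (Set.iUnion₂_subset fun j _ => hsub (j + 1))
      (Finset.measurableSet_biUnion _ fun j _ => hmeas (j + 1)),
      measureReal_biUnion_finset (hdis k) fun j _ => hmeas _]
  have hwin : μ.real (M.winEvent τ ∩ M.N ⁻¹' {n}) ≤
      ∑ k ∈ Finset.range n, μ.real (M.stopAt τ n (k + 1)) * noSuccessProb p n (k + 1) := by
    calc μ.real (M.winEvent τ ∩ M.N ⁻¹' {n})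
        ≤ μ.real (⋃ k ∈ Finset.range n,
          M.stopAt τ n (k + 1) ∩ ⋂ j ∈ Finset.Ioc (k + 1) n, M.X j ⁻¹' {false}) := by
          refine ENNReal.toReal_mono (measure_ne_top _ _) (measure_mono_ae ?_)
          filter_upwards [M.ae_regular] with ω hω h
          exact M.winEvent_subset hω.1 hω.2 h
      _ ≤ ∑ k ∈ Finset.range n, μ.real
          (M.stopAt τ n (k + 1) ∩ ⋂ j ∈ Finset.Ioc (k + 1) n, M.X j ⁻¹' {false}) :=
          measureReal_biUnion_finset_le _ _
      _ = _ := by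
          refine Finset.sum_congr rfl fun k _ => ?_
          rw [M.measure_past_inter (M.measurableSet_stopAt hτ n (k + 1))
            (fun j hj => (Finset.mem_Ioc.1 hj).1) fun _ => {false}, noSuccessProb]
          congr 1
          refine Finset.prod_congr rfl fun j hj => M.measureReal_X_false hp0 ?_
          have := (Finset.mem_Ioc.1 hj).1
          omega
  refine hwin.trans (sum_reward_le_potential (d := fun k => μ.real (M.stopAt τ n k))
    (fun k _ => ?_) (fun k => measureReal_nonneg) (fun k _ => ?_) hV hVr hVn)
  · rw [← hrem]; exact measureReal_nonneg
  -- Not having stopped during the first `k` trials is an event of `past k`, hence independent of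
  -- outcome `k + 1`; stopping there requires both this event and a success.
  · have hA : MeasurableSet[M.past k]
        (M.N ⁻¹' {n} \ ⋃ j ∈ Finset.range k, M.stopAt τ n (j + 1)) :=
      .diff (M.measurable_past_N k .of_discrete) (Finset.measurableSet_biUnion _ fun j hj =>
        M.past_mono (Finset.mem_range.1 hj) _ (M.measurableSet_stopAt hτ n (j + 1)))
    have h1 := M.measure_past_inter hA (T := {k + 1}) (by simp) fun _ => {true}
    rw [Finset.prod_singleton, M.measureReal_X_true hp0 (by omega), hrem] at h1
    rw [mul_comm, ← h1]
    refine measureReal_mono fun ω hω => ⟨⟨hω.1.1.1, ?_⟩, ?_⟩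
    · intro h
      obtain ⟨j, hj, hj'⟩ := Set.mem_iUnion₂.1 h
      exact Set.disjoint_left.1 (M.disjoint_stopAt n (by omega)
        (Nat.succ_lt_succ (Finset.mem_range.1 hj))) hj' hω
    · simpa using hω.1.1.2

end Model

/-! ### Concentration of the counts. -/

/-- The number of `i ∈ {1, …, n}` with `x i ≤ t`. -/
noncomputable def empiricalCount (n : ℕ) (t : ℝ) (x : ℕ → ℝ) : ℕ :=
  ((Finset.Icc 1 n).filter (fun i => x i ≤ t)).card

theorem measurable_empiricalCount (n : ℕ) (t : ℝ) : Measurable (empiricalCount n t) :=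
  (Model.measurable_card_filter_le t).comp (measurable_const.prodMk measurable_id)

/-- The number of positions up to `t` among the first `n` deviates from `n t` by at least `η n`. -/
def deviation (n : ℕ) (η t : ℝ) : Set (ℕ → ℝ) := {x | η * n ≤ |(empiricalCount n t x : ℝ) - n * t|}

theorem measurableSet_deviation (n : ℕ) (η t : ℝ) : MeasurableSet (deviation n η t) := by
  have h : Measurable fun x => (empiricalCount n t x : ℝ) :=
    measurable_from_top.comp (measurable_empiricalCount n t)
  exact measurableSet_le measurable_const (h.sub_const _).abs

namespace Model

variable {Ω : Type*} [MeasurableSpace Ω] {μ : Measure Ω} {p : ℕ → ℝ} (M : Model μ p)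

/-- Chebyshev's inequality for a sum of `n` independent indicators of mean `t`, each of variance at
most `1`. -/
theorem measureReal_deviation_le [IsProbabilityMeasure μ] {t η : ℝ} (ht : t ∈ Set.Icc (0 : ℝ) 1)
    (hη : 0 < η) {n : ℕ} (hn : 1 ≤ n) :
    μ.real ((fun ω n => M.U n ω) ⁻¹' deviation n η t) ≤ 1 / (η ^ 2 * n) := by
  set f : ℝ → ℝ := (Set.Iic t).indicator 1 with hf
  have hfm : Measurable f := measurable_one.indicator measurableSet_Iic
  set Y : ℕ → Ω → ℝ := fun i => f ∘ M.U i with hY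
  have hYm : ∀ i, Measurable (Y i) := fun i => hfm.comp (M.measurable_U i)
  have hYb : ∀ i ω, Y i ω ∈ Set.Icc (0 : ℝ) 1 := by
    intro i ω
    simp only [hY, hf, Function.comp_apply, Set.indicator_apply, Pi.one_apply]
    split_ifs <;> simp
  have hYL : ∀ i, MemLp (Y i) 2 μ := fun i =>
    MemLp.of_bound (hYm i).aestronglyMeasurable 1 (.of_forall fun ω => by
      rw [Real.norm_eq_abs, abs_le]
      have := hYb i ω
      exact ⟨by linarith [this.1], this.2⟩)
  have hYint : ∀ i, 1 ≤ i → ∫ ω, Y i ω ∂μ = t := by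
    intro i hi
    have h1 : ∫ ω, Y i ω ∂μ = ∫ x, f x ∂(μ.map (M.U i)) :=
      (integral_map (M.measurable_U i).aemeasurable hfm.aestronglyMeasurable).symm
    rw [h1, M.law_U i hi, hf, integral_indicator_one measurableSet_Iic, Measure.real,
      Measure.restrict_apply measurableSet_Iic]
    have : Set.Iic t ∩ Set.Icc 0 1 = Set.Icc 0 t := by
      ext x
      simp only [Set.mem_inter_iff, Set.mem_Iic, Set.mem_Icc]
      exact ⟨fun h => ⟨h.2.1, h.1⟩, fun h => ⟨h.2, h.1, h.2.trans ht.2⟩⟩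
    rw [this, Real.volume_Icc, sub_zero, ENNReal.toReal_ofReal ht.1]
  set S : Ω → ℝ := ∑ i ∈ Finset.Icc 1 n, Y i with hS
  have hSL : MemLp S 2 μ := memLp_finsetSum' _ fun i _ => hYL i
  have hSint : ∫ ω, S ω ∂μ = n * t := by
    simp only [hS, Finset.sum_apply]
    rw [integral_finsetSum _ fun i _ => (hYL i).integrable (by norm_num)]
    rw [Finset.sum_congr rfl fun i hi => hYint i (Finset.mem_Icc.1 hi).1]
    simp
  have hScount : ∀ ω, S ω = empiricalCount n t fun n => M.U n ω := by
    intro ω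
    rw [empiricalCount, ← Finset.sum_boole, hS, Finset.sum_apply]
    rfl
  have hvar : variance S μ ≤ n := by
    rw [hS, IndepFun.variance_sum (fun i _ => hYL i) fun i _ j _ hij =>
      (M.indep_U.indepFun hij).comp hfm hfm]
    calc ∑ i ∈ Finset.Icc 1 n, variance (Y i) μ ≤ ∑ i ∈ Finset.Icc 1 n, 1 :=
          Finset.sum_le_sum fun i _ =>
            (variance_le_sq_of_bounded (.of_forall (hYb i)) (hYm i).aemeasurable).trans
              (by norm_num)
      _ = n := by simp
  have hn0 : (0 : ℝ) < n := by exact_mod_cast hn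
  have hset : (fun ω n => M.U n ω) ⁻¹' deviation n η t = {ω | η * n ≤ |S ω - ∫ ω, S ω ∂μ|} := by
    ext ω
    rw [hSint]
    simp only [Set.mem_preimage, deviation, Set.mem_ofPred_eq, hScount]
  rw [hset]
  have h1 := meas_ge_le_variance_div_sq hSL (mul_pos hη hn0)
  refine (ENNReal.toReal_le_of_le_ofReal (div_nonneg (variance_nonneg _ _) (sq_nonneg _)) h1).trans
    ?_
  calc variance S μ / (η * n) ^ 2 ≤ n / (η * n) ^ 2 := by gcongr
    _ = 1 / (η ^ 2 * n) := by field_simp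

theorem measureReal_N_inter (n : ℕ) {C : Set (ℕ → ℝ)} (hC : MeasurableSet C) :
    μ.real (M.N ⁻¹' {n} ∩ (fun ω n => M.U n ω) ⁻¹' C) =
      μ.real (M.N ⁻¹' {n}) * μ.real ((fun ω n => M.U n ω) ⁻¹' C) := by
  have h : IndepFun M.N (fun ω n => M.U n ω) μ := M.indep_N.comp measurable_id measurable_fst
  simp only [Measure.real]
  rw [h.measure_inter_preimage_eq_mul _ _ (measurableSet_singleton n) hC, ENNReal.toReal_mul]

/-! ### Lower bound for a fixed number of trials. -/

/-- Among the trials with index in `(m, n]`, the only success is the one with index `k`. -/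
def onlySuccess (m n k : ℕ) : Set Ω :=
  ⋂ j ∈ Finset.Ioc m n, M.X j ⁻¹' (if j = k then {true} else {false})

theorem measurableSet_onlySuccess (m n k : ℕ) : MeasurableSet (M.onlySuccess m n k) :=
  Finset.measurableSet_biInter _ fun j _ => M.measurable_X j .of_discrete

theorem measureReal_inter_onlySuccess [IsProbabilityMeasure μ] (hp0 : ∀ k, 1 ≤ k → 0 ≤ p k)
    {A : Set Ω} (hA : MeasurableSet[M.past 0] A) {m n k : ℕ} (hk : k ∈ Finset.Ioc m n)
    (hpk : p k ≠ 1) :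
    μ.real (A ∩ M.onlySuccess m n k) = μ.real A * (noSuccessProb p n m * (p k / (1 - p k))) := by
  have hpk' : 1 - p k ≠ 0 := sub_ne_zero.2 hpk.symm
  have hk1 : 1 ≤ k := by have := (Finset.mem_Ioc.1 hk).1; omega
  rw [onlySuccess, M.measure_past_inter hA (fun j hj => by
    have := (Finset.mem_Ioc.1 hj).1; omega) fun j => if j = k then {true} else {false}]
  congr 1
  rw [noSuccessProb, ← Finset.mul_prod_erase _ _ hk, ← Finset.mul_prod_erase _ _ hk, if_pos rfl,
    M.measureReal_X_true hp0 hk1, Finset.prod_congr rfl fun j hj => ?_]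
  · field_simp
  · have h1 := Finset.mem_erase.1 hj
    have h2 := (Finset.mem_Ioc.1 h1.2).1
    rw [if_neg h1.1, M.measureReal_X_false hp0 (by omega)]

/-- Trials up to `K` occur by `s`, and those from `K + 1` to `m₁` by `t₁`, all before their cutoffs,
so nothing is accepted up to index `m₁`. The only later success has index beyond `m₂`, hence comes
after `t₂` and its own cutoff, and is accepted. -/
theorem mem_winEvent_of_onlySuccess {b : ℕ → ℝ} {ω : Ω}
    (hU : ∀ i, 1 ≤ i → M.U i ω ∈ Set.Ioo 0 1) {m₁ m₂ k : ℕ} {t₁ t₂ s : ℝ} {K : ℕ}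
    (hs : ∀ j, 1 ≤ j → j ≤ K → s < b j) (ht₁ : ∀ j, K < j → t₁ < b j)
    (ht₂ : ∀ j, m₂ < j → b j ≤ t₂) (hKs : K ≤ M.count s ω)
    (hm₁ : m₁ ≤ M.count t₁ ω) (hm₂ : M.count t₂ ω ≤ m₂) (hk : k ∈ Finset.Ioc m₂ (M.N ω))
    (h12 : m₁ ≤ m₂) (hω : ω ∈ M.onlySuccess m₁ (M.N ω) k) :
    ω ∈ M.winEvent (M.markov (cutoffSet b)) := by
  rw [Finset.mem_Ioc] at hk
  have hX : ∀ j, m₁ < j → j ≤ M.N ω → M.X j ω ∈ (if j = k then {true} else {false} : Set Bool) :=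
    fun j h1 h2 => Set.mem_iInter₂.1 hω j (Finset.mem_Ioc.2 ⟨h1, h2⟩)
  have hkS : M.IsSuccess k ω := by
    have := hX k (by omega) hk.2
    rw [if_pos rfl] at this
    exact ⟨by omega, hk.2, this⟩
  have huniq : ∀ j, m₁ < j → M.IsSuccess j ω → j = k := by
    intro j hj hjS
    by_contra hne
    have := hX j hj hjS.2.1
    rw [if_neg hne, Set.mem_singleton_iff, hjS.2.2] at this
    exact absurd this (by decide)
  have hT1 : M.epoch k ω < 1 := by
    obtain ⟨t, ht, ht1⟩ : ∃ t, (∀ i ∈ Finset.Icc 1 (M.N ω), M.U i ω ≤ t) ∧ t < 1 := by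
      have hev : ∀ᶠ t in 𝓝[<] (1 : ℝ), ∀ i ∈ Finset.Icc 1 (M.N ω), M.U i ω < t := by
        rw [Filter.eventually_all_finset]
        intro i hi
        exact (eventually_gt_nhds (hU i (Finset.mem_Icc.1 hi).1).2).filter_mono nhdsWithin_le_nhds
      obtain ⟨t, ht, ht1⟩ := (hev.and eventually_mem_nhdsWithin).exists
      exact ⟨t, fun i hi => (ht i hi).le, ht1⟩
    refine lt_of_le_of_lt ((M.epoch_le_iff hkS.1 hk.2).2 ?_) ht1
    rw [count, Finset.filter_true_of_mem ht]
    simpa using hk.2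
  have hTk : t₂ < M.epoch k ω := by
    by_contra h
    have := (M.epoch_le_iff hkS.1 hk.2).1 (not_lt.1 h)
    omega
  have hkB : (M.epoch k ω, k) ∈ cutoffSet b := ⟨hkS.1, (ht₂ k hk.1).trans hTk.le, hT1⟩
  rcases M.markov_eq_one_or (cutoffSet b) ω with h | ⟨j, hj, hjB, hτ, -⟩
  · exact absurd hkB (h.2 k hkS)
  · have hjk : j = k := by
      refine huniq j ?_ hj
      by_contra hjm
      have hbj : b j ≤ M.epoch j ω := hjB.2.1
      rcases le_or_gt j K with hjK | hjK
      · have := (M.epoch_le_iff hj.1 hj.2.1).2 (hjK.trans hKs)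
        linarith [hs j hj.1 hjK]
      · have := (M.epoch_le_iff hj.1 hj.2.1).2 ((not_lt.1 hjm).trans hm₁)
        linarith [ht₁ j hjK]
    subst hjk
    refine ⟨hτ ▸ hT1, j, hj, hτ, fun i hi hiS => ?_⟩
    have := huniq i (by omega) hiS
    omega

end Model

/-- Given a large number of trials, the strategy whose cutoffs converge to `e^{-1/θ}` wins with
probability at least `e⁻¹ - ε`. -/
theorem exists_le_winProb_markov.{u} {θ : ℝ} (hθ : 0 < θ) {b : ℕ → ℝ} (hb : ∀ k, 1 ≤ k → 0 < b k)
    (hlim : Tendsto b atTop (𝓝 (Real.exp (-1 / θ)))) {ε : ℝ} (hε : 0 < ε) :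
    ∃ n₀ : ℕ, ∀ (Ω : Type u) [MeasurableSpace Ω] (μ : Measure Ω) [IsProbabilityMeasure μ]
      (M : Model μ (profile θ)) (n : ℕ), n₀ ≤ n →
      (Real.exp (-1) - ε) * μ.real (M.N ⁻¹' {n}) ≤
        μ.real (M.winEvent (M.markov (cutoffSet b)) ∩ M.N ⁻¹' {n}) := by
  obtain ⟨ε', hε'0, hε'1, hε'2⟩ : ∃ ε' : ℝ, 0 < ε' ∧ 2 * ε' ≤ ε ∧ ε' ≤ Real.exp (-1) :=
    ⟨min (ε / 2) (Real.exp (-1)), lt_min (by positivity) (Real.exp_pos _),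
      by linarith [min_le_left (ε / 2) (Real.exp (-1))], min_le_right _ _⟩
  obtain ⟨δ, hδ, hc1, hc2, n₁, hn₁⟩ := exists_window hθ hε'0
  set c := Real.exp (-1 / θ) with hc
  obtain ⟨K, hK⟩ := eventually_atTop.1
    ((hlim.eventually_const_lt (by linarith : c - δ < c)).and
      (hlim.eventually_lt_const (by linarith : c < c + δ)))
  -- A common time before the first `K` cutoffs, which carry no information beyond positivity.
  obtain ⟨s, hs0, hs1, hs⟩ : ∃ s : ℝ, 0 < s ∧ s < 1 ∧ ∀ j ∈ Finset.Icc 1 K, s < b j := by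
    have h1 : ∀ᶠ s in 𝓝[>] (0 : ℝ), ∀ j ∈ Finset.Icc 1 K, s < b j := by
      rw [Filter.eventually_all_finset]
      intro j hj
      exact (eventually_lt_nhds (hb j (Finset.mem_Icc.1 hj).1)).filter_mono nhdsWithin_le_nhds
    have h2 : ∀ᶠ s in 𝓝[>] (0 : ℝ), s < 1 :=
      (eventually_lt_nhds one_pos).filter_mono nhdsWithin_le_nhds
    obtain ⟨s, h1, h2, h3⟩ := (h1.and (h2.and eventually_mem_nhdsWithin)).exists
    exact ⟨s, h3, h2, h1⟩
  -- `n₂` makes the three Chebyshev bounds sum to at most `ε'`; `n₃` puts `K` trials before `s`;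
  -- `n₄` gives `K ≤ m₂`, so that cutoffs beyond `m₂` are near `c`.
  obtain ⟨n₂, hn₂⟩ := exists_nat_ge ((1 / (s / 2) ^ 2 + 2 / δ ^ 2) / ε')
  obtain ⟨n₃, hn₃⟩ := exists_nat_ge (K / (s / 2))
  obtain ⟨n₄, hn₄⟩ := exists_nat_ge (K / (c + 2 * δ))
  refine ⟨max (max n₁ n₂) (max (max n₃ n₄) 1), fun Ω _ μ _ M n hn => ?_⟩
  simp only [max_le_iff] at hn
  obtain ⟨⟨hn1, hn2⟩, ⟨hn3, hn4⟩, hn5⟩ := hn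
  have hn0 : (0 : ℝ) < n := by exact_mod_cast hn5
  obtain ⟨hm1, hwin⟩ := hn₁ n hn1
  set m₁ := ⌊(c - 2 * δ) * n⌋₊ with hm₁
  set m₂ := ⌈(c + 2 * δ) * n⌉₊ with hm₂
  have hp0 : ∀ k, 1 ≤ k → 0 ≤ profile θ k := fun k hk => (profile_pos hθ hk).le
  have hm₁hi : (m₁ : ℝ) ≤ (c - 2 * δ) * n := Nat.floor_le (by positivity)
  have hm₂lo : (c + 2 * δ) * n ≤ m₂ := Nat.le_ceil _
  have hc0 : 0 < c := Real.exp_pos _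
  have h12 : m₁ ≤ m₂ := by
    have : (m₁ : ℝ) ≤ m₂ := by nlinarith
    exact_mod_cast this
  have hKs : (K : ℝ) ≤ s / 2 * n := by
    have : K / (s / 2) ≤ n := hn₃.trans (by exact_mod_cast hn3)
    rwa [div_le_iff₀ (by positivity), mul_comm] at this
  have hKm : K ≤ m₂ := by
    have : K / (c + 2 * δ) ≤ n := hn₄.trans (by exact_mod_cast hn4)
    rw [div_le_iff₀ (by positivity), mul_comm] at this
    have : (K : ℝ) ≤ m₂ := this.trans hm₂lo
    exact_mod_cast this
  -- Off `C`, the counts at `s`, `c - δ` and `c + δ` are at least `K`, at least `m₁` and at most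
  -- `m₂`; the gap between `δ` and `2 * δ` absorbs the deviation.
  set C : Set (ℕ → ℝ) := deviation n (s / 2) s ∪ deviation n δ (c - δ) ∪ deviation n δ (c + δ)
    with hC
  have hCm : MeasurableSet C := ((measurableSet_deviation _ _ _).union
    (measurableSet_deviation _ _ _)).union (measurableSet_deviation _ _ _)
  set U : Ω → ℕ → ℝ := fun ω n => M.U n ω with hU
  have hUm : Measurable U := measurable_pi_lambda _ M.measurable_U
  have hCμ : μ.real (U ⁻¹' C) ≤ ε' := by
    have h1 : μ.real (U ⁻¹' C) ≤ 1 / ((s / 2) ^ 2 * n) + 1 / (δ ^ 2 * n) + 1 / (δ ^ 2 * n) := by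
      rw [hC, Set.preimage_union, Set.preimage_union]
      refine (measureReal_union_le _ _).trans (add_le_add ((measureReal_union_le _ _).trans
        (add_le_add ?_ ?_)) ?_)
      · exact M.measureReal_deviation_le ⟨hs0.le, hs1.le⟩ (by positivity) hn5
      · exact M.measureReal_deviation_le ⟨by linarith, by linarith⟩ hδ hn5
      · exact M.measureReal_deviation_le ⟨by linarith, by linarith⟩ hδ hn5
    have h2 : (1 / (s / 2) ^ 2 + 2 / δ ^ 2) / ε' ≤ n := hn₂.trans (by exact_mod_cast hn2)
    rw [div_le_iff₀ hε'0, mul_comm, ← div_le_iff₀ hn0] at h2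
    refine h1.trans (le_trans (le_of_eq ?_) h2)
    field_simp
    ring
  set A : Set Ω := M.N ⁻¹' {n} ∩ U ⁻¹' Cᶜ with hA
  have hAm : MeasurableSet[M.past 0] A :=
    (M.measurable_past_N 0 .of_discrete).inter
      ((measurable_snd.comp (measurable_fst.comp (comap_measurable (M.pastMap 0))))
        hCm.compl)
  have hAμ : (1 - ε') * μ.real (M.N ⁻¹' {n}) ≤ μ.real A := by
    rw [hA, M.measureReal_N_inter n hCm.compl, mul_comm]
    refine mul_le_mul_of_nonneg_left ?_ measureReal_nonneg
    have : μ.real (U ⁻¹' Cᶜ) = 1 - μ.real (U ⁻¹' C) := by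
      rw [Set.preimage_compl, probReal_compl_eq_one_sub (hUm hCm)]
    linarith
  have hdis : (↑(Finset.Ioc m₂ n) : Set ℕ).PairwiseDisjoint fun k => A ∩ M.onlySuccess m₁ n k := by
    intro i hi j hj hij
    have hi := Finset.mem_Ioc.1 (Finset.mem_coe.1 hi)
    refine Set.disjoint_left.2 fun ω h1 h2 => ?_
    have h3 := Set.mem_iInter₂.1 h1.2 i (Finset.mem_Ioc.2 ⟨by omega, hi.2⟩)
    have h4 := Set.mem_iInter₂.1 h2.2 i (Finset.mem_Ioc.2 ⟨by omega, hi.2⟩)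
    simp only [if_true, if_neg hij, Set.mem_preimage, Set.mem_singleton_iff] at h3 h4
    rw [h3] at h4
    exact absurd h4 (by decide)
  have hsum : μ.real (⋃ k ∈ Finset.Ioc m₂ n, A ∩ M.onlySuccess m₁ n k)
      = μ.real A * (noSuccessProb (profile θ) n m₁ * oddsSum (profile θ) n m₂) := by
    rw [measureReal_biUnion_finset hdis fun k _ =>
      (M.past_le 0 _ hAm).inter (M.measurableSet_onlySuccess m₁ n k), oddsSum, Finset.mul_sum,
      Finset.mul_sum]
    refine Finset.sum_congr rfl fun k hk => ?_
    have hk' := Finset.mem_Ioc.1 hk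
    exact M.measureReal_inter_onlySuccess hp0 hAm (Finset.mem_Ioc.2 ⟨by omega, hk'.2⟩)
      (profile_lt_one hθ (by omega)).ne
  have hsub : μ.real (⋃ k ∈ Finset.Ioc m₂ n, A ∩ M.onlySuccess m₁ n k) ≤
      μ.real (M.winEvent (M.markov (cutoffSet b)) ∩ M.N ⁻¹' {n}) := by
    refine ENNReal.toReal_mono (measure_ne_top _ _) (measure_mono_ae ?_)
    filter_upwards [M.ae_regular] with ω hω h
    obtain ⟨k, hk, ⟨hNn, hωC⟩, hωk⟩ := Set.mem_iUnion₂.1 h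
    have hNn : M.N ω = n := hNn
    subst hNn
    refine ⟨?_, rfl⟩
    simp only [hC, Set.mem_preimage, Set.mem_compl_iff, Set.mem_union, not_or, deviation,
      Set.mem_ofPred_eq, not_le, abs_lt] at hωC
    obtain ⟨⟨⟨h1, -⟩, ⟨h2, -⟩⟩, ⟨-, h3⟩⟩ := hωC
    refine M.mem_winEvent_of_onlySuccess (s := s) (t₁ := c - δ) (t₂ := c + δ) (K := K) hω.1
      (fun j h1 h2 => hs j (Finset.mem_Icc.2 ⟨h1, h2⟩)) (fun j hj => (hK j hj.le).1)
      (fun j hj => (hK j (by omega)).2.le) ?_ ?_ ?_ hk h12 hωk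
    · have : (K : ℝ) ≤ M.count s ω := by
        change (K : ℝ) ≤ empiricalCount (M.N ω) s (U ω)
        linarith
      exact_mod_cast this
    · have : (m₁ : ℝ) ≤ M.count (c - δ) ω := by
        change (m₁ : ℝ) ≤ empiricalCount (M.N ω) (c - δ) (U ω)
        linarith
      exact_mod_cast this
    · have : (M.count (c + δ) ω : ℝ) ≤ m₂ := by
        change (empiricalCount (M.N ω) (c + δ) (U ω) : ℝ) ≤ m₂
        linarith
      exact_mod_cast this
  rw [hsum] at hsub
  refine le_trans ?_ hsub
  have h1 : Real.exp (-1) ≤ 1 := Real.exp_le_one_iff.2 (by norm_num)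
  have ha : 0 ≤ μ.real (M.N ⁻¹' {n}) := measureReal_nonneg
  calc (Real.exp (-1) - ε) * μ.real (M.N ⁻¹' {n})
      ≤ ((1 - ε') * (Real.exp (-1) - ε')) * μ.real (M.N ⁻¹' {n}) := by
        refine mul_le_mul_of_nonneg_right ?_ ha
        nlinarith
    _ = ((1 - ε') * μ.real (M.N ⁻¹' {n})) * (Real.exp (-1) - ε') := by ring
    _ ≤ μ.real A * (Real.exp (-1) - ε') := mul_le_mul_of_nonneg_right hAμ (by linarith)
    _ ≤ _ := mul_le_mul_of_nonneg_left hwin measureReal_nonneg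

/-! ### From a fixed to a random number of trials. -/

theorem measureReal_le_add_of_fiber_le {Ω : Type*} [MeasurableSpace Ω] {μ : Measure Ω}
    [IsProbabilityMeasure μ] {N : Ω → ℕ} (hN : Measurable N) (W : Set Ω) {n₀ : ℕ} {c : ℝ}
    (hc : 0 ≤ c) (h : ∀ n, n₀ ≤ n → μ.real (W ∩ N ⁻¹' {n}) ≤ μ.real (N ⁻¹' {n}) * c) :
    μ.real W ≤ μ.real {ω | N ω ≤ n₀} + c := by
  have hfib : ∀ y ∈ Set.Ioi n₀, MeasurableSet (N ⁻¹' {y}) := fun y _ => hN .of_discrete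
  have h1 : μ (W ∩ N ⁻¹' Set.Ioi n₀) ≤ ENNReal.ofReal c := by
    -- Restricting `μ` to `W` gives countable additivity over the fibres of `N` without
    -- measurability of `W`.
    have h2 := tsum_measure_preimage_singleton (μ := μ.restrict W) (Set.to_countable _) hfib
    rw [Measure.restrict_apply (hN .of_discrete), Set.inter_comm] at h2
    rw [← h2]
    calc ∑' n : Set.Ioi n₀, μ.restrict W (N ⁻¹' {n.1})
        ≤ ∑' n : Set.Ioi n₀, μ (N ⁻¹' {n.1}) * ENNReal.ofReal c := by
          refine ENNReal.tsum_le_tsum fun n => ?_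
          rw [Measure.restrict_apply (hN .of_discrete), Set.inter_comm, ← ofReal_measureReal,
            ← ofReal_measureReal, ← ENNReal.ofReal_mul measureReal_nonneg]
          exact ENNReal.ofReal_le_ofReal (h n.1 (le_of_lt n.2))
      _ = μ (N ⁻¹' Set.Ioi n₀) * ENNReal.ofReal c := by
          rw [ENNReal.tsum_mul_right, tsum_measure_preimage_singleton (Set.to_countable _) hfib]
      _ ≤ ENNReal.ofReal c := mul_le_of_le_one_left zero_le prob_le_one
  have h3 : W ⊆ {ω | N ω ≤ n₀} ∪ (W ∩ N ⁻¹' Set.Ioi n₀) := by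
    intro ω hω
    rcases le_or_gt (N ω) n₀ with h | h
    exacts [Or.inl h, Or.inr ⟨hω, h⟩]
  refine (measureReal_mono h3).trans ((measureReal_union_le _ _).trans ?_)
  gcongr
  exact ENNReal.toReal_le_of_le_ofReal hc h1

theorem le_measureReal_of_fiber_le {Ω : Type*} [MeasurableSpace Ω] {μ : Measure Ω}
    [IsProbabilityMeasure μ] {N : Ω → ℕ} (hN : Measurable N) (W : Set Ω) {n₀ : ℕ} {c : ℝ}
    (hc : 0 ≤ c) (hc1 : c ≤ 1)
    (h : ∀ n, n₀ ≤ n → c * μ.real (N ⁻¹' {n}) ≤ μ.real (W ∩ N ⁻¹' {n})) :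
    c - μ.real {ω | N ω ≤ n₀} ≤ μ.real W := by
  have hfib : ∀ y ∈ Set.Ioi n₀, MeasurableSet (N ⁻¹' {y}) := fun y _ => hN .of_discrete
  have h1 : ENNReal.ofReal c * μ (N ⁻¹' Set.Ioi n₀) ≤ μ W := by
    have h2 := tsum_measure_preimage_singleton (μ := μ.restrict W) (Set.to_countable _) hfib
    rw [Measure.restrict_apply (hN .of_discrete), Set.inter_comm] at h2
    refine le_trans ?_ (measure_mono (Set.inter_subset_left (t := N ⁻¹' Set.Ioi n₀)))
    rw [← h2, ← tsum_measure_preimage_singleton (Set.to_countable _) hfib, ← ENNReal.tsum_mul_left]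
    refine ENNReal.tsum_le_tsum fun n => ?_
    rw [Measure.restrict_apply (hN .of_discrete), Set.inter_comm, ← ofReal_measureReal,
      ← ofReal_measureReal, ← ENNReal.ofReal_mul hc]
    exact ENNReal.ofReal_le_ofReal (h n.1 (le_of_lt n.2))
  have h2 : c * μ.real (N ⁻¹' Set.Ioi n₀) ≤ μ.real W := by
    have := ENNReal.toReal_mono (measure_ne_top _ _) h1
    rwa [ENNReal.toReal_mul, ENNReal.toReal_ofReal hc] at this
  have h3 : μ.real (N ⁻¹' Set.Ioi n₀) = 1 - μ.real {ω | N ω ≤ n₀} := by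
    rw [← probReal_compl_eq_one_sub (s := {ω | N ω ≤ n₀})
      (hN (MeasurableSet.of_discrete (s := Set.Iic n₀)))]
    congr 1
    ext ω; simp
  rw [h3] at h2
  have : 0 ≤ μ.real {ω | N ω ≤ n₀} := measureReal_nonneg
  nlinarith

theorem Model.winProb_le_optimalWinProb {Ω : Type*} [MeasurableSpace Ω] {μ : Measure Ω}
    [IsProbabilityMeasure μ] {p : ℕ → ℝ} (M : Model μ p) {τ : Ω → ℝ} (hτ : M.IsStrategy τ) :
    M.winProb τ ≤ M.optimalWinProb := by
  refine le_csSup ⟨1, ?_⟩ ⟨τ, hτ, rfl⟩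
  rintro w ⟨σ, -, rfl⟩
  exact measureReal_le_one

/-- The optimal winning probability is asymptotically at most `e⁻¹`. -/
theorem exists_optimalWinProb_le.{u} {θ : ℝ} (hθ : 0 < θ) {ε : ℝ} (hε : 0 < ε) :
    ∃ n₀ : ℕ, ∀ (Ω : Type u) [MeasurableSpace Ω] (μ : Measure Ω) [IsProbabilityMeasure μ]
      (M : Model μ (profile θ)),
      M.optimalWinProb ≤ μ.real {ω | M.N ω ≤ n₀} + (Real.exp (-1) + ε) := by
  obtain ⟨n₀, hn₀⟩ := exists_potential hθ hε
  refine ⟨n₀, fun Ω _ μ _ M => ?_⟩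
  have hc : 0 ≤ Real.exp (-1) + ε := by positivity
  refine Real.sSup_le ?_ (add_nonneg measureReal_nonneg hc)
  rintro w ⟨τ, hτ, rfl⟩
  refine measureReal_le_add_of_fiber_le M.measurable_N _ hc fun n hn => ?_
  obtain ⟨V, hV, hVr, hVn, hV0⟩ := hn₀ n hn
  exact (M.measureReal_winEvent_le (fun k hk => (profile_pos hθ hk).le) hτ hV hVr hVn).trans
    (mul_le_mul_of_nonneg_left hV0 measureReal_nonneg)

end LastSuccess

theorem mainTheorem10 (θ : ℝ) (hθ : 0 < θ)
    (b : ℕ → ℝ) (hb_pos : ∀ k, 1 ≤ k → 0 < b k)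
    (hb_lim : Tendsto b atTop (𝓝 (Real.exp (-1 / θ))))
    {ι : Type*} (l : Filter ι) {Ω : ι → Type*} [∀ i, MeasurableSpace (Ω i)]
    (μ : ∀ i, Measure (Ω i)) [∀ i, IsProbabilityMeasure (μ i)]
    (M : ∀ i, LastSuccess.Model (μ i) (LastSuccess.profile θ))
    (hN : ∀ K : ℕ, Tendsto (fun i => (μ i).real {ω | (M i).N ω ≤ K}) l (𝓝 0)) :
    (∀ i, (M i).IsStrategy ((M i).markov (LastSuccess.cutoffSet b))) ∧
    Tendsto (fun i => (M i).optimalWinProb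
      - (M i).winProb ((M i).markov (LastSuccess.cutoffSet b))) l (𝓝 0) ∧
    Tendsto (fun i => (M i).winProb ((M i).markov (LastSuccess.cutoffSet b))) l
      (𝓝 (Real.exp (-1))) := by
  have hstrat : ∀ i, (M i).IsStrategy ((M i).markov (LastSuccess.cutoffSet b)) :=
    fun i => (M i).isStrategy_markov_cutoffSet hb_pos
  have hle : ∀ i, (M i).winProb ((M i).markov (LastSuccess.cutoffSet b)) ≤ (M i).optimalWinProb :=
    fun i => (M i).winProb_le_optimalWinProb (hstrat i)
  have hupper : ∀ a, Real.exp (-1) < a → ∀ᶠ i in l, (M i).optimalWinProb < a := by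
    intro a ha
    obtain ⟨n₀, hn₀⟩ := LastSuccess.exists_optimalWinProb_le hθ
      (show 0 < (a - Real.exp (-1)) / 2 by linarith)
    filter_upwards [(hN n₀).eventually_lt_const (show 0 < (a - Real.exp (-1)) / 2 by linarith)]
      with i hi
    linarith [hn₀ (Ω i) (μ i) (M i)]
  have hlower : ∀ a, a < Real.exp (-1) → ∀ᶠ i in l,
      a < (M i).winProb ((M i).markov (LastSuccess.cutoffSet b)) := by
    intro a ha
    -- One `ε` pays for the loss at fixed `n`, the other for the small values of `N`; `ε ≤ e⁻¹`
    -- keeps the fibrewise constant nonnegative.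
    obtain ⟨ε, hε, hε1, hε2⟩ : ∃ ε : ℝ, 0 < ε ∧ 2 * ε ≤ Real.exp (-1) - a ∧ ε ≤ Real.exp (-1) :=
      ⟨min ((Real.exp (-1) - a) / 2) (Real.exp (-1)), lt_min (by linarith) (Real.exp_pos _),
        by linarith [min_le_left ((Real.exp (-1) - a) / 2) (Real.exp (-1))], min_le_right _ _⟩
    have he : Real.exp (-1) ≤ 1 := Real.exp_le_one_iff.2 (by norm_num)
    obtain ⟨n₀, hn₀⟩ := LastSuccess.exists_le_winProb_markov hθ hb_pos hb_lim hε
    filter_upwards [(hN n₀).eventually_lt_const hε] with i hi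
    have := LastSuccess.le_measureReal_of_fiber_le (M i).measurable_N
      ((M i).winEvent ((M i).markov (LastSuccess.cutoffSet b))) (by linarith) (by linarith)
      (hn₀ (Ω i) (μ i) (M i))
    change a < (μ i).real ((M i).winEvent ((M i).markov (LastSuccess.cutoffSet b)))
    linarith
  have hwin : Tendsto (fun i => (M i).winProb ((M i).markov (LastSuccess.cutoffSet b))) l
      (𝓝 (Real.exp (-1))) :=
    tendsto_order.2 ⟨hlower, fun a ha => (hupper a ha).mono fun i hi => (hle i).trans_lt hi⟩
  have hopt : Tendsto (fun i => (M i).optimalWinProb) l (𝓝 (Real.exp (-1))) :=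
    tendsto_order.2 ⟨fun a ha => (hlower a ha).mono fun i hi => hi.trans_le (hle i), hupper⟩
  refine ⟨hstrat, ?_, hwin⟩
  simpa using hopt.sub hwin
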